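/- Let $n\ge 3$, let $(\widetilde M,\tilde g,J)$ be a complex space form $\widetilde M(c)$ of real dimension $2n$, i.e. a Kähler manifold with constant holomorphic sectional curvature $c$, and let $M$ be a Lagrangian submanifold of $\widetilde M(c)$, i.e. an (isometrically immersed) Riemannian submanifold of dimension $n$ such that $J(T_xM)\subset T_x^{\perp}M$ for every $x\in M$. Let $h$ be the second fundamental form of $M$ in $\widetilde M(c)$ and let $H=\frac1n\sum_{i=1}^n h(e_i,e_i)$ be the mean curvature vector, where $\{e_1,\dots,e_n\}$ is an orthonormal frame of $T_xM$. Let $K$ be the sectional curvature of $M$, let $$\tau(x)=\sum_{1\le i<j\le n}K(e_i\wedge e_j)$$ be the scalar curvature of $M$, and for an integer $k\in[2,n]$ put $$\theta_k(x)=\frac1{k-1}\min_{L,\,X}\operatorname{Ric}_L(X),\qquad \delta_k(M)=\tau-\theta_k,$$ where $L$ runs over the $k$-dimensional subspaces of $T_xM$ and $X$ over the unit vectors of $L$, and where $\operatorname{Ric}_L(X)=\sum_{j=2}^kK(X\wedge e'_j)$ for any orthonormal frame $\{e'_1=X,e'_2,\dots,e'_k\}$ of $L$. Then at every point of $M$ $$\delta_n(M)\le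 \frac{(n+1)(n-2)}{8}\,c+\frac{(3n-1)(n-2)n^2}{2(3n+5)(n-1)}\,\|H\|^2 .$$ -/

import Mathlib

open Bundle
open scoped Manifold ContDiff InnerProductSpace

noncomputable section

namespace RiemannianGeometry

section Intrinsic

variable {E : Type*} [NormedAddCommGroup E] [NormedSpace ℝ E]
  {M : Type*} [TopologicalSpace M] [ChartedSpace E M] [IsManifold 𝓘(ℝ, E) ∞ M]

/-- For `q` in the domain of the preferred chart `φ` at `p`, the linear map
`(dφ_q)⁻¹ : E → T_q M` sending a coordinate vector to the tangent vector it represents. -/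
def ofCoord (p q : M) : E →L[ℝ] TangentSpace 𝓘(ℝ, E) q :=
  (trivializationAt E (TangentSpace 𝓘(ℝ, E)) p).symmL ℝ q

/-- For `q` in the domain of the preferred chart `φ` at `p`, the differential
`dφ_q : T_q M → E` sending a tangent vector to its coordinates. -/
def toCoord (p q : M) : TangentSpace 𝓘(ℝ, E) q →L[ℝ] E :=
  (trivializationAt E (TangentSpace 𝓘(ℝ, E)) p).continuousLinearMapAt ℝ q

/-- The map `toCoord p` is the differential of the preferred chart at `p`. -/
theorem toCoord_eq_mfderiv {p q : M} (hq : q ∈ (chartAt E p).source) :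
    toCoord p q = mfderiv 𝓘(ℝ, E) 𝓘(ℝ, E) (extChartAt 𝓘(ℝ, E) p) q :=
  TangentBundle.continuousLinearMapAt_trivializationAt hq

/-- On the domain of the preferred chart, `ofCoord p` is the inverse of `toCoord p`. -/
theorem toCoord_ofCoord {p q : M} (hq : q ∈ (chartAt E p).source) (u : E) :
    toCoord p q (ofCoord p q u) = u :=
  (trivializationAt E (TangentSpace 𝓘(ℝ, E)) p).continuousLinearMapAt_symmL (R := ℝ)
    (by simpa using hq) u

/-- On the domain of the preferred chart, `ofCoord p` is the inverse of `toCoord p`. -/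
theorem ofCoord_toCoord {p q : M} (hq : q ∈ (chartAt E p).source)
    (u : TangentSpace 𝓘(ℝ, E) q) : ofCoord p q (toCoord p q u) = u :=
  (trivializationAt E (TangentSpace 𝓘(ℝ, E)) p).symmL_continuousLinearMapAt (R := ℝ)
    (by simpa using hq) u

/-- An endomorphism field of the tangent bundle, read in the preferred chart at `p`,
as a function of the coordinates `y`. -/
def endCoord (J : ∀ p : M, TangentSpace 𝓘(ℝ, E) p →L[ℝ] TangentSpace 𝓘(ℝ, E) p)
    (p : M) (y : E) : E →L[ℝ] E :=
  let q := (extChartAt 𝓘(ℝ, E) p).symm y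
  (toCoord p q).comp ((J q).comp (ofCoord p q))

variable [RiemannianBundle (fun x : M ↦ TangentSpace 𝓘(ℝ, E) x)]

/-- The Riemannian metric read in the preferred chart at `p`, as a function of the
coordinates `y` with values in the bilinear forms on the coordinate space. -/
def metricCoord (p : M) (y : E) : E →L[ℝ] E →L[ℝ] ℝ :=
  let q := (extChartAt 𝓘(ℝ, E) p).symm y
  (innerSL ℝ (E := TangentSpace 𝓘(ℝ, E) q)).bilinearComp (ofCoord p q) (ofCoord p q)

/-- The Christoffel symbols `Γ(u, v)` of the Levi-Civita connection in the preferred chart at `p`,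
at the point with coordinates `y`:
`g(Γ(u, v), w) = (1/2) ((∂_u g)(v, w) + (∂_v g)(u, w) - (∂_w g)(u, v))`.
Thus `∇_u W = ∂_u W + Γ(u, W)` in coordinates. -/
def christoffel (p : M) (y : E) (u v : E) : E :=
  let dg := fderiv ℝ (metricCoord p) y
  (metricCoord p y).inverse ((1 / 2 : ℝ) • (dg u v + dg v u - (dg.flip u).flip v))

/-- The curvature `R(u, v) w = ∇_u ∇_v w - ∇_v ∇_u w` of constant coordinate vector fields
`u`, `v`, `w` (whose brackets vanish), in the preferred chart at `p`, at coordinates `y`. -/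
def curvatureCoord (p : M) (y : E) (u v w : E) : E :=
  fderiv ℝ (fun z ↦ christoffel p z v w) y u - fderiv ℝ (fun z ↦ christoffel p z u w) y v
    + christoffel p y u (christoffel p y v w) - christoffel p y v (christoffel p y u w)

/-- The Riemann curvature endomorphism `R(u, v) w` at `p`, with the sign convention
`R(X, Y) Z = ∇_X ∇_Y Z - ∇_Y ∇_X Z - ∇_[X, Y] Z`. -/
def curvature (p : M) (u v w : TangentSpace 𝓘(ℝ, E) p) : TangentSpace 𝓘(ℝ, E) p :=
  ofCoord p p (curvatureCoord p (extChartAt 𝓘(ℝ, E) p p)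
    (toCoord p p u) (toCoord p p v) (toCoord p p w))

/-- The sectional curvature of the plane spanned by two linearly independent vectors. -/
def sectionalCurvature (p : M) (u v : TangentSpace 𝓘(ℝ, E) p) : ℝ :=
  ⟪curvature p u v v, u⟫_ℝ / (‖u‖ ^ 2 * ‖v‖ ^ 2 - ⟪u, v⟫_ℝ ^ 2)

variable [FiniteDimensional ℝ E]

/-- Tangent spaces are finite-dimensional. -/
instance finiteDimensional_tangentSpace (x : M) :
    FiniteDimensional ℝ (TangentSpace 𝓘(ℝ, E) x) :=
  inferInstanceAs (FiniteDimensional ℝ E)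

variable (E) in
/-- An orthonormal frame of `T_x M`. -/
def frame (x : M) :
    OrthonormalBasis (Fin (Module.finrank ℝ (TangentSpace 𝓘(ℝ, E) x))) ℝ
      (TangentSpace 𝓘(ℝ, E) x) :=
  stdOrthonormalBasis ℝ (TangentSpace 𝓘(ℝ, E) x)

variable (E) in
/-- The scalar curvature `τ(x) = ∑_{i < j} K(e_i ∧ e_j)`, for an orthonormal frame of `T_x M`. -/
def scalarCurvature (x : M) : ℝ :=
  ∑ i, ∑ j ∈ Finset.Ioi i, sectionalCurvature x (frame E x i) (frame E x j)

variable (E) in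
/-- The set of all values `Ric_L(X) = ∑_{j ≠ i} K(X ∧ e_j)`, where `L` is a `k`-dimensional
subspace of `T_x M`, `X` a unit vector of `L`, and `e` an orthonormal frame of `L` one of whose
members, `e_i`, is `X`. -/
def kRicciValues (k : ℕ) (x : M) : Set ℝ :=
  {r | ∃ L : Submodule ℝ (TangentSpace 𝓘(ℝ, E) x), Module.finrank ℝ L = k ∧
    ∃ X ∈ L, ‖X‖ = 1 ∧ ∃ (e : Fin k → TangentSpace 𝓘(ℝ, E) x) (i : Fin k),
      Orthonormal ℝ e ∧ (∀ j, e j ∈ L) ∧ e i = X ∧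
      r = ∑ j ∈ Finset.univ.erase i, sectionalCurvature x X (e j)}

variable (E) in
/-- The Ricci curvature of `k`-order, `θ_k(x) = (1 / (k - 1)) min Ric_L(X)`. -/
def theta (k : ℕ) (x : M) : ℝ := 1 / ((k : ℝ) - 1) * sInf (kRicciValues E k x)

variable (E) in
/-- The invariant `δ_k(M) = τ - θ_k`. -/
def delta (k : ℕ) (x : M) : ℝ := scalarCurvature E x - theta E k x

/-- `J` is a Kähler structure on the Riemannian manifold `M`: a smooth almost complex structure
that is orthogonal for the metric and parallel for the Levi-Civita connection. -/
structure IsKahler (J : ∀ p : M, TangentSpace 𝓘(ℝ, E) p →L[ℝ] TangentSpace 𝓘(ℝ, E) p) :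
    Prop where
  contMDiff : ContMDiff 𝓘(ℝ, E) (𝓘(ℝ, E).prod 𝓘(ℝ, E →L[ℝ] E)) ∞
    (fun p ↦ TotalSpace.mk' (E →L[ℝ] E)
      (E := fun p : M ↦ TangentSpace 𝓘(ℝ, E) p →L[ℝ] TangentSpace 𝓘(ℝ, E) p) p (J p))
  apply_apply : ∀ (p : M) (v : TangentSpace 𝓘(ℝ, E) p), J p (J p v) = -v
  inner_apply : ∀ (p : M) (v w : TangentSpace 𝓘(ℝ, E) p), ⟪J p v, J p w⟫_ℝ = ⟪v, w⟫_ℝ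
  /-- `(∇_u J) v = (∂_u J) v + Γ(u, J v) - J Γ(u, v) = 0`. -/
  parallel : ∀ (p : M) (u v : E),
    let y := extChartAt 𝓘(ℝ, E) p p
    fderiv ℝ (endCoord J p) y u v + christoffel p y u (endCoord J p y v)
      - endCoord J p y (christoffel p y u v) = 0

/-- `(M, J)` is a complex space form `M(c)`: a Kähler manifold of constant holomorphic sectional
curvature `c`. -/
structure IsComplexSpaceForm
    (J : ∀ p : M, TangentSpace 𝓘(ℝ, E) p →L[ℝ] TangentSpace 𝓘(ℝ, E) p) (c : ℝ) : Prop where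
  isKahler : IsKahler J
  sectionalCurvature_eq : ∀ (p : M) (u : TangentSpace 𝓘(ℝ, E) p), u ≠ 0 →
    sectionalCurvature p u (J p u) = c

end Intrinsic

section Submanifold

variable {E : Type*} [NormedAddCommGroup E] [NormedSpace ℝ E] [FiniteDimensional ℝ E]
  {M : Type*} [TopologicalSpace M] [ChartedSpace E M] [IsManifold 𝓘(ℝ, E) ∞ M]
  [RiemannianBundle (fun x : M ↦ TangentSpace 𝓘(ℝ, E) x)]
  {E' : Type*} [NormedAddCommGroup E'] [NormedSpace ℝ E'] [FiniteDimensional ℝ E']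
  {M' : Type*} [TopologicalSpace M'] [ChartedSpace E' M'] [IsManifold 𝓘(ℝ, E') ∞ M']
  [RiemannianBundle (fun x : M' ↦ TangentSpace 𝓘(ℝ, E') x)]

variable (E E') in
/-- `f` is a smooth isometric immersion, i.e. it exhibits `M` with its metric as an (immersed)
Riemannian submanifold of `M'`. -/
structure IsIsometricImmersion (f : M → M') : Prop where
  contMDiff : ContMDiff 𝓘(ℝ, E) 𝓘(ℝ, E') ∞ f
  inner_mfderiv : ∀ (x : M) (u v : TangentSpace 𝓘(ℝ, E) x),
    ⟪mfderiv 𝓘(ℝ, E) 𝓘(ℝ, E') f x u, mfderiv 𝓘(ℝ, E) 𝓘(ℝ, E') f x v⟫_ℝ = ⟪u, v⟫_ℝ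

variable (E) in
/-- `f` exhibits `M` as a Lagrangian submanifold of `(M', J)`: the real dimension of `M'` is twice
that of `M`, and `J` maps each tangent space of `M` into the normal space. -/
structure IsLagrangian (f : M → M')
    (J : ∀ p : M', TangentSpace 𝓘(ℝ, E') p →L[ℝ] TangentSpace 𝓘(ℝ, E') p) : Prop where
  isIsometricImmersion : IsIsometricImmersion E E' f
  finrank_eq : Module.finrank ℝ E' = 2 * Module.finrank ℝ E
  inner_eq_zero : ∀ (x : M) (u v : TangentSpace 𝓘(ℝ, E) x),
    ⟪J (f x) (mfderiv 𝓘(ℝ, E) 𝓘(ℝ, E') f x u), mfderiv 𝓘(ℝ, E) 𝓘(ℝ, E') f x v⟫_ℝ = 0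

/-- The second fundamental form `h(X, Y) = ∇'_X (df Y) - df (∇_X Y)` at `x` (Gauss' formula),
computed in the preferred charts at `x` and `f x` with constant coordinate vector fields; here
`F` is `f` read in these charts, so that `∇'_u (dF v) = d²F(u, v) + Γ'(dF u, dF v)` and
`∇_u v = Γ(u, v)`. -/
def secondFundamentalForm (f : M → M') (x : M) (u v : TangentSpace 𝓘(ℝ, E) x) :
    TangentSpace 𝓘(ℝ, E') (f x) :=
  let F : E → E' := writtenInExtChartAt 𝓘(ℝ, E) 𝓘(ℝ, E') x f
  let y : E := extChartAt 𝓘(ℝ, E) x x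
  let a : E := toCoord x x u
  let b : E := toCoord x x v
  ofCoord (f x) (f x)
    (fderiv ℝ (fderiv ℝ F) y a b + christoffel (f x) (F y) (fderiv ℝ F y a) (fderiv ℝ F y b)
      - fderiv ℝ F y (christoffel x y a b))

variable (E E') in
/-- The mean curvature vector `H = (1 / n) ∑_i h(e_i, e_i)`, for an orthonormal frame of `T_x M`,
where `n` is the dimension of `M`. -/
def meanCurvature (f : M → M') (x : M) : TangentSpace 𝓘(ℝ, E') (f x) :=
  (1 / (Module.finrank ℝ E : ℝ)) • ∑ i, secondFundamentalForm f x (frame E x i) (frame E x i)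

end Submanifold

end RiemannianGeometry

end

/-! The inequality is pointwise linear algebra once three geometric facts are available. The Gauss
equation (`IsIsometricOn.gauss_sub`) expresses the curvature of `M` through that of the ambient
space and the second fundamental form `h`. A complex space form has sectional curvature `c / 4` on
totally real planes (`totallyReal_curvature`), and tangent planes of a Lagrangian submanifold are
totally real. Finally, `J e_1, ..., J e_n` is an orthonormal normal frame, in which the coefficients
`σ i j r = ⟪h(e_i, e_j), J e_r⟫` are symmetric in all three indices, because `J` is parallel
(`IsIsometricOn.inner_acceleration_J`).

For an orthonormal frame with distinguished vector `e_o`, the quantity `τ - Ric(e_o) / (n - 1)` is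
then a multiple of `c` plus a quadratic expression in `σ`, to be bounded by a multiple of `∑ r, (∑
i, σ i i r) ^ 2 = n ^ 2 * ‖H‖ ^ 2`. This is `symmetric_cubic_bound`. The squares `σ i j r ^ 2` with
`i, j, r` distinct enter with nonpositive sign and are dropped; by total symmetry the remaining
terms involve only the numbers `σ i i r` and decouple into one quadratic form for each `r`.
Cauchy-Schwarz and completing squares bound each form. The case `r ≠ o` dictates the constant; the
case `r = o` has room to spare.

The bound holds for every frame and every choice of `e_o`, so it survives the infimum that defines
`θ_n`. The geometric facts are proved for metrics on open subsets of the model space and transferred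
through charts. -/

open Filter Topology

noncomputable section

set_option maxSynthPendingDepth 3
set_option maxHeartbeats 400000
set_option linter.unusedSectionVars false

namespace RiemannianGeometry

/-! ### Levi-Civita calculus of a metric on an open set of a vector space. -/

section LocalTheory

variable {E : Type*} [NormedAddCommGroup E] [NormedSpace ℝ E]
  {E' : Type*} [NormedAddCommGroup E'] [NormedSpace ℝ E']

/-- The Christoffel symbols of the first kind of a field of bilinear forms. -/
def christoffelFirst (G : E → E →L[ℝ] E →L[ℝ] ℝ) (z : E) : E →L[ℝ] E →L[ℝ] E →L[ℝ] ℝ :=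
  (1 / 2 : ℝ) • (fderiv ℝ G z + (fderiv ℝ G z).flip
    - (ContinuousLinearMap.flipₗᵢ ℝ E E ℝ).toContinuousLinearEquiv.toContinuousLinearMap.comp
        (fderiv ℝ G z).flip)

/-- The Christoffel symbols of a field of bilinear forms, as a continuous bilinear map. -/
def christoffelMap (G : E → E →L[ℝ] E →L[ℝ] ℝ) (z : E) : E →L[ℝ] E →L[ℝ] E :=
  (ContinuousLinearMap.compL ℝ E (E →L[ℝ] ℝ) E (G z).inverse).comp (christoffelFirst G z)

/-- The curvature of the Levi-Civita connection of `G`. -/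
def curvatureMap (G : E → E →L[ℝ] E →L[ℝ] ℝ) (y : E) (u v w : E) : E :=
  fderiv ℝ (christoffelMap G) y u v w - fderiv ℝ (christoffelMap G) y v u w
    + christoffelMap G y u (christoffelMap G y v w) - christoffelMap G y v (christoffelMap G y u w)

theorem christoffelFirst_apply (G : E → E →L[ℝ] E →L[ℝ] ℝ) (z u v w : E) :
    christoffelFirst G z u v w
      = (1 / 2 : ℝ) * (fderiv ℝ G z u v w + fderiv ℝ G z v u w - fderiv ℝ G z w u v) := by
  simp [christoffelFirst]

theorem christoffelMap_apply (G : E → E →L[ℝ] E →L[ℝ] ℝ) (z u v : E) :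
    christoffelMap G z u v = (G z).inverse (christoffelFirst G z u v) := rfl

/-- `G` is a smooth Riemannian metric on the open set `U`. -/
structure IsMetricOn (G : E → E →L[ℝ] E →L[ℝ] ℝ) (U : Set E) : Prop where
  isOpen : IsOpen U
  contDiffOn : ContDiffOn ℝ ∞ G U
  symm : ∀ z u v, G z u v = G z v u
  pos : ∀ z ∈ U, ∀ u, u ≠ 0 → 0 < G z u u

theorem ContDiffAt.fderiv_top {f : E → E'} {y : E} (hf : ContDiffAt ℝ ∞ f y) :
    ContDiffAt ℝ ∞ (fderiv ℝ f) y :=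
  hf.fderiv_right (m := ∞) (by simp)

theorem ContDiffAt.fderiv_fderiv_comm {f : E → E'} {y : E} (hf : ContDiffAt ℝ ∞ f y) (u v : E) :
    fderiv ℝ (fderiv ℝ f) y u v = fderiv ℝ (fderiv ℝ f) y v u :=
  (hf.isSymmSndFDerivAt (by simp; exact WithTop.coe_le_coe.2 le_top)).eq u v

theorem fderiv_apply_const {f : E → E →L[ℝ] E'} {y : E} (hf : DifferentiableAt ℝ f y) (u v : E) :
    fderiv ℝ (fun z ↦ f z v) y u = fderiv ℝ f y u v := by
  have := (hf.hasFDerivAt.clm_apply (hasFDerivAt_const v y)).fderiv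
  rw [this]; simp

theorem fderiv_apply_const₂ {E'' : Type*} [NormedAddCommGroup E''] [NormedSpace ℝ E'']
    {f : E → E' →L[ℝ] E'' →L[ℝ] E'} {y : E} (hf : DifferentiableAt ℝ f y) (u : E) (v : E')
    (w : E'') :
    fderiv ℝ (fun z ↦ f z v w) y u = fderiv ℝ f y u v w := by
  have := ((hf.hasFDerivAt.clm_apply (hasFDerivAt_const v y)).clm_apply
    (hasFDerivAt_const w y)).fderiv
  rw [this]; simp

variable [FiniteDimensional ℝ E] [FiniteDimensional ℝ E']

namespace IsMetricOn

variable {G : E → E →L[ℝ] E →L[ℝ] ℝ} {U : Set E} {y : E}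

theorem contDiffAt (hG : IsMetricOn G U) (hy : y ∈ U) : ContDiffAt ℝ ∞ G y :=
  hG.contDiffOn.contDiffAt (hG.isOpen.mem_nhds hy)

theorem differentiableAt (hG : IsMetricOn G U) (hy : y ∈ U) : DifferentiableAt ℝ G y :=
  (hG.contDiffAt hy).differentiableAt (by simp)

theorem eq_of_forall (hG : IsMetricOn G U) (hy : y ∈ U) {a b : E}
    (h : ∀ w, G y a w = G y b w) : a = b := by
  by_contra hab
  have h1 := hG.pos y hy (a - b) (sub_ne_zero.2 hab)
  have h2 := h (a - b)
  rw [map_sub (G y), sub_apply, h2, sub_self] at h1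
  exact lt_irrefl _ h1

/-- `christoffelMap` is built on `ContinuousLinearMap.inverse`, which is zero at non-invertible
maps. Positivity gives injectivity, and equality of dimensions does the rest. -/
theorem isInvertible (hG : IsMetricOn G U) (hy : y ∈ U) : (G y).IsInvertible := by
  have hinj : Function.Injective (G y) := fun a b hab ↦
    hG.eq_of_forall hy fun w ↦ by rw [hab]
  have hdim : Module.finrank ℝ E = Module.finrank ℝ (E →L[ℝ] ℝ) := by
    rw [← LinearEquiv.finrank_eq (LinearMap.toContinuousLinearMap (𝕜 := ℝ) (E := E) (F' := ℝ))]
    exact (Subspace.dual_finrank_eq (K := ℝ) (V := E)).symm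
  let e : E ≃L[ℝ] (E →L[ℝ] ℝ) :=
    (LinearEquiv.ofInjectiveOfFinrankEq (G y : E →ₗ[ℝ] (E →L[ℝ] ℝ)) hinj
      hdim).toContinuousLinearEquiv
  exact ⟨e, by ext; rfl⟩

theorem apply_christoffelMap (hG : IsMetricOn G U) (hy : y ∈ U) (u v w : E) :
    G y (christoffelMap G y u v) w
      = (1 / 2 : ℝ) * (fderiv ℝ G y u v w + fderiv ℝ G y v u w - fderiv ℝ G y w u v) := by
  rw [← christoffelFirst_apply, christoffelMap_apply]
  obtain ⟨e, he⟩ := hG.isInvertible hy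
  rw [← he, ContinuousLinearMap.inverse_equiv]
  simp

theorem contDiffAt_christoffelMap (hG : IsMetricOn G U) (hy : y ∈ U) :
    ContDiffAt ℝ ∞ (christoffelMap G) y := by
  have h1 : ContDiffAt ℝ ∞ (fderiv ℝ G) y := ContDiffAt.fderiv_top (hG.contDiffAt hy)
  have hflip : ContDiffAt ℝ ∞ (fun z ↦ (fderiv ℝ G z).flip) y :=
    (ContinuousLinearMap.flipₗᵢ ℝ E E (E →L[ℝ] ℝ)).contDiff.contDiffAt.comp y h1
  have h2 : ContDiffAt ℝ ∞ (christoffelFirst G) y :=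
    ((h1.add hflip).sub (contDiffAt_const.clm_comp hflip)).const_smul (1 / 2 : ℝ)
  have hinv : ContDiffAt ℝ ∞ (fun z ↦ (G z).inverse) y :=
    ((hG.isInvertible hy).contDiffAt_map_inverse).comp y (hG.contDiffAt hy)
  exact (((ContinuousLinearMap.compL ℝ E (E →L[ℝ] ℝ) E).contDiff.contDiffAt.comp y hinv)).clm_comp h2

theorem differentiableAt_christoffelMap (hG : IsMetricOn G U) (hy : y ∈ U) :
    DifferentiableAt ℝ (christoffelMap G) y :=
  (hG.contDiffAt_christoffelMap hy).differentiableAt (by simp)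

theorem fderiv_symm (hG : IsMetricOn G U) (hy : y ∈ U) (u v w : E) :
    fderiv ℝ G y u v w = fderiv ℝ G y u w v := by
  have hd := hG.differentiableAt hy
  have h : (fun z ↦ G z v w) = fun z ↦ G z w v := funext fun z ↦ hG.symm z v w
  have key : ∀ v w, fderiv ℝ (fun z ↦ G z v w) y u = fderiv ℝ G y u v w := fun v w ↦ by
    rw [((hd.hasFDerivAt.clm_apply (hasFDerivAt_const v y)).clm_apply
      (hasFDerivAt_const w y)).fderiv]
    simp
  rw [← key, ← key, h]

theorem christoffelMap_symm (hG : IsMetricOn G U) (hy : y ∈ U) (u v : E) :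
    christoffelMap G y u v = christoffelMap G y v u :=
  hG.eq_of_forall hy fun w ↦ by
    rw [hG.apply_christoffelMap hy, hG.apply_christoffelMap hy, hG.fderiv_symm hy w u v]
    ring

/-- Compatibility of the connection with the metric: in the sum of the two Koszul formulas all
derivatives of `G` cancel except the one along `u`. -/
theorem fderiv_eq (hG : IsMetricOn G U) (hy : y ∈ U) (u v w : E) :
    fderiv ℝ G y u v w
      = G y (christoffelMap G y u v) w + G y v (christoffelMap G y u w) := by
  rw [hG.symm y v, hG.apply_christoffelMap hy, hG.apply_christoffelMap hy,
    hG.fderiv_symm hy w u v, hG.fderiv_symm hy v u w, hG.fderiv_symm hy u w v]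
  ring

theorem fderiv_christoffelMap_symm (hG : IsMetricOn G U) (hy : y ∈ U) (u v w : E) :
    fderiv ℝ (christoffelMap G) y u v w = fderiv ℝ (christoffelMap G) y u w v := by
  have hd := hG.differentiableAt_christoffelMap hy
  rw [← fderiv_apply_const₂ hd, ← fderiv_apply_const₂ hd]
  congr 1
  refine Filter.EventuallyEq.fderiv_eq ?_
  filter_upwards [hG.isOpen.mem_nhds hy] with z hz using hG.christoffelMap_symm hz v w

/-- The Levi-Civita connection is metric, for vector fields along a map. -/
theorem fderiv_inner_along {D : Type*} [NormedAddCommGroup D] [NormedSpace ℝ D] {F : D → E} {x : D}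
    {F' : D →L[ℝ] E} {X Y : D → E} {X' Y' : D →L[ℝ] E}
    (hG : IsMetricOn G U) (hx : F x ∈ U) (hF : HasFDerivAt F F' x)
    (hX : HasFDerivAt X X' x) (hY : HasFDerivAt Y Y' x) (u : D) :
    fderiv ℝ (fun z ↦ G (F z) (X z) (Y z)) x u
      = G (F x) (X' u + christoffelMap G (F x) (F' u) (X x)) (Y x)
        + G (F x) (X x) (Y' u + christoffelMap G (F x) (F' u) (Y x)) := by
  have h1 : HasFDerivAt (fun z ↦ G (F z)) ((fderiv ℝ G (F x)).comp F') x :=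
    (hG.differentiableAt hx).hasFDerivAt.comp x hF
  rw [((h1.clm_apply hX).clm_apply hY).fderiv]
  simp [hG.fderiv_eq hx]
  ring

theorem curvatureMap_antisymm (G : E → E →L[ℝ] E →L[ℝ] ℝ) (y u v w : E) :
    curvatureMap G y u v w = -curvatureMap G y v u w := by
  simp only [curvatureMap]; abel

/-- Since the connection is torsion-free near `y`, both the Christoffel map and its derivative are
symmetric in the last two slots, and the terms cancel in pairs. -/
theorem curvatureMap_bianchi (hG : IsMetricOn G U) (hy : y ∈ U) (u v w : E) :
    curvatureMap G y u v w + curvatureMap G y v w u + curvatureMap G y w u v = 0 := by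
  simp only [curvatureMap]
  rw [hG.fderiv_christoffelMap_symm hy u v w, hG.fderiv_christoffelMap_symm hy v w u,
    hG.fderiv_christoffelMap_symm hy w u v, hG.christoffelMap_symm hy v w,
    hG.christoffelMap_symm hy u w, hG.christoffelMap_symm hy u v]
  abel

/-- Skew-symmetry of `R(u, v)`: metric compatibility computes the Hessian of `z ↦ G z w w`, and its
antisymmetric part, which vanishes, is twice this expression. -/
theorem apply_curvatureMap_self (hG : IsMetricOn G U) (hy : y ∈ U) (u v w : E) :
    G y (curvatureMap G y u v w) w = 0 := by
  have hφ : ContDiffAt ℝ ∞ (fun z ↦ G z w w) y :=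
    ((hG.contDiffAt hy).clm_apply contDiffAt_const).clm_apply contDiffAt_const
  have hd := hG.differentiableAt_christoffelMap hy
  have h1 : ∀ z ∈ U, ∀ v, fderiv ℝ (fun z ↦ G z w w) z v = 2 * G z (christoffelMap G z v w) w := by
    intro z hz v
    have := hG.fderiv_inner_along (F := fun z ↦ z) hz (hasFDerivAt_id z) (hasFDerivAt_const w z)
      (hasFDerivAt_const w z) v
    rw [this, hG.symm z w]
    simp; ring
  have h2 : ∀ u v, fderiv ℝ (fderiv ℝ (fun z ↦ G z w w)) y u v
      = 2 * (G y (fderiv ℝ (christoffelMap G) y u v w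
          + christoffelMap G y u (christoffelMap G y v w)) w
        + G y (christoffelMap G y v w) (christoffelMap G y u w)) := by
    intro u v
    rw [← fderiv_apply_const ((ContDiffAt.fderiv_top hφ).differentiableAt (by simp))]
    have he : (fun z ↦ fderiv ℝ (fun z ↦ G z w w) z v) =ᶠ[𝓝 y]
        fun z ↦ 2 * G z (christoffelMap G z v w) w := by
      filter_upwards [hG.isOpen.mem_nhds hy] with z hz using h1 z hz v
    have hX : HasFDerivAt (fun z ↦ christoffelMap G z v w)
        (fderiv ℝ (fun z ↦ christoffelMap G z v w) y) y :=
      ((hd.clm_apply (differentiableAt_const v)).clm_apply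
        (differentiableAt_const w)).hasFDerivAt
    have h3 := hG.fderiv_inner_along (F := fun z ↦ z) hy (hasFDerivAt_id y) hX
      (hasFDerivAt_const w y) u
    have hdd : DifferentiableAt ℝ (fun z ↦ G z (christoffelMap G z v w) w) y :=
      ((hG.differentiableAt hy).clm_apply hX.differentiableAt).clm_apply (differentiableAt_const w)
    rw [he.fderiv_eq, fderiv_const_mul hdd]
    simp only [smul_apply, h3, fderiv_apply_const₂ hd]
    simp
  have h4 := ContDiffAt.fderiv_fderiv_comm hφ u v
  rw [h2, h2, hG.symm y (christoffelMap G y u w)] at h4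
  simp only [curvatureMap, map_add, map_sub, add_apply,
    sub_apply] at h4 ⊢
  linarith

end IsMetricOn

/-- `F` is a smooth isometric immersion of the metric `G` on `U` into the metric `G'` on `U'`. -/
structure IsIsometricOn (G : E → E →L[ℝ] E →L[ℝ] ℝ) (U : Set E)
    (G' : E' → E' →L[ℝ] E' →L[ℝ] ℝ) (U' : Set E') (F : E → E') : Prop where
  source : IsMetricOn G U
  target : IsMetricOn G' U'
  contDiffOn : ContDiffOn ℝ ∞ F U
  mapsTo : Set.MapsTo F U U'
  inner_eq : ∀ z ∈ U, ∀ u v, G' (F z) (fderiv ℝ F z u) (fderiv ℝ F z v) = G z u v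

/-- The ambient covariant derivative `∇'_u (dF v)`. -/
def acceleration (G' : E' → E' →L[ℝ] E' →L[ℝ] ℝ) (F : E → E') (z u v : E) : E' :=
  fderiv ℝ (fderiv ℝ F) z u v + christoffelMap G' (F z) (fderiv ℝ F z u) (fderiv ℝ F z v)

/-! ### Isometric immersions in coordinates and the Gauss equation. -/

namespace IsIsometricOn

variable {G : E → E →L[ℝ] E →L[ℝ] ℝ} {U : Set E} {G' : E' → E' →L[ℝ] E' →L[ℝ] ℝ} {U' : Set E'}
  {F : E → E'} {y : E}

theorem contDiffAt (h : IsIsometricOn G U G' U' F) (hy : y ∈ U) : ContDiffAt ℝ ∞ F y :=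
  h.contDiffOn.contDiffAt (h.source.isOpen.mem_nhds hy)

theorem hasFDerivAt (h : IsIsometricOn G U G' U' F) (hy : y ∈ U) :
    HasFDerivAt F (fderiv ℝ F y) y :=
  ((h.contDiffAt hy).differentiableAt (by simp)).hasFDerivAt

theorem hasFDerivAt_fderiv (h : IsIsometricOn G U G' U' F) (hy : y ∈ U) :
    HasFDerivAt (fderiv ℝ F) (fderiv ℝ (fderiv ℝ F) y) y :=
  ((ContDiffAt.fderiv_top (h.contDiffAt hy)).differentiableAt (by simp)).hasFDerivAt

theorem hasFDerivAt_fderiv_apply (h : IsIsometricOn G U G' U' F) (hy : y ∈ U) (v : E) :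
    HasFDerivAt (fun z ↦ fderiv ℝ F z v) ((fderiv ℝ (fderiv ℝ F) y).flip v) y := by
  convert (h.hasFDerivAt_fderiv hy).clm_apply (hasFDerivAt_const v y) using 1
  ext; simp

theorem acceleration_symm (h : IsIsometricOn G U G' U' F) (hy : y ∈ U) (u v : E) :
    acceleration G' F y u v = acceleration G' F y v u := by
  simp only [acceleration]
  rw [ContDiffAt.fderiv_fderiv_comm (h.contDiffAt hy),
    h.target.christoffelMap_symm (h.mapsTo hy)]

/-- Derivative of `z ↦ G' (dF v) (Y z)` along `F`. -/
theorem fderiv_inner_fderiv (h : IsIsometricOn G U G' U' F) (hy : y ∈ U) {Y : E → E'}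
    {Y' : E →L[ℝ] E'} (hY : HasFDerivAt Y Y' y) (u v : E) :
    fderiv ℝ (fun z ↦ G' (F z) (fderiv ℝ F z v) (Y z)) y u
      = G' (F y) (acceleration G' F y u v) (Y y)
        + G' (F y) (fderiv ℝ F y v)
          (Y' u + christoffelMap G' (F y) (fderiv ℝ F y u) (Y y)) := by
  rw [h.target.fderiv_inner_along (h.mapsTo hy) (h.hasFDerivAt hy)
    (h.hasFDerivAt_fderiv_apply hy v) hY u]
  rfl

/-- The tangential part of the ambient derivative is the Levi-Civita derivative of the induced
metric. Differentiating `G = F^* G'` expresses `∂G` by accelerations, whose symmetry makes the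
Koszul combination collapse to one term. -/
theorem inner_acceleration (h : IsIsometricOn G U G' U' F) (hy : y ∈ U) (u v w : E) :
    G' (F y) (acceleration G' F y u v) (fderiv ℝ F y w) = G y (christoffelMap G y u v) w := by
  have key : ∀ u v w, fderiv ℝ G y u v w
      = G' (F y) (acceleration G' F y u v) (fderiv ℝ F y w)
        + G' (F y) (fderiv ℝ F y v) (acceleration G' F y u w) := by
    intro u v w
    have h1 := h.fderiv_inner_fderiv hy (h.hasFDerivAt_fderiv_apply hy w) u v
    have he : (fun z ↦ G' (F z) (fderiv ℝ F z v) (fderiv ℝ F z w)) =ᶠ[𝓝 y] fun z ↦ G z v w := by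
      filter_upwards [h.source.isOpen.mem_nhds hy] with z hz using h.inner_eq z hz v w
    rw [he.fderiv_eq, (((h.source.differentiableAt hy).hasFDerivAt.clm_apply
      (hasFDerivAt_const v y)).clm_apply (hasFDerivAt_const w y)).fderiv] at h1
    simpa [acceleration] using h1
  have hs := h.target.symm (F y)
  rw [h.source.apply_christoffelMap hy, key u, key v, key w,
    h.acceleration_symm hy v u, h.acceleration_symm hy w u, h.acceleration_symm hy w v,
    hs (fderiv ℝ F y v), hs (fderiv ℝ F y u) (acceleration G' F y v w)]
  ring

theorem hasFDerivAt_acceleration (h : IsIsometricOn G U G' U' F) (hy : y ∈ U) (v w : E) :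
    ∃ A' : E →L[ℝ] E', HasFDerivAt (fun z ↦ acceleration G' F z v w) A' y ∧
      ∀ u, A' u = fderiv ℝ (fderiv ℝ (fderiv ℝ F)) y u v w
        + (fderiv ℝ (christoffelMap G') (F y) (fderiv ℝ F y u) (fderiv ℝ F y v) (fderiv ℝ F y w)
          + christoffelMap G' (F y) (fderiv ℝ (fderiv ℝ F) y u v) (fderiv ℝ F y w)
          + christoffelMap G' (F y) (fderiv ℝ F y v) (fderiv ℝ (fderiv ℝ F) y u w)) := by
  have h3 : HasFDerivAt (fderiv ℝ (fderiv ℝ F)) (fderiv ℝ (fderiv ℝ (fderiv ℝ F)) y) y :=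
    ((ContDiffAt.fderiv_top (ContDiffAt.fderiv_top (h.contDiffAt hy))).differentiableAt
      (by simp)).hasFDerivAt
  have hc : HasFDerivAt (fun z ↦ christoffelMap G' (F z))
      ((fderiv ℝ (christoffelMap G') (F y)).comp (fderiv ℝ F y)) y :=
    (h.target.differentiableAt_christoffelMap (h.mapsTo hy)).hasFDerivAt.comp y (h.hasFDerivAt hy)
  refine ⟨_, ((h3.clm_apply (hasFDerivAt_const v y)).clm_apply (hasFDerivAt_const w y)).add
    ((hc.clm_apply (h.hasFDerivAt_fderiv_apply hy v)).clm_apply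
      (h.hasFDerivAt_fderiv_apply hy w)), fun u ↦ ?_⟩
  simp
  abel

/-- The Gauss equation, in terms of `∇'_u (dF v)`. -/
theorem gauss (h : IsIsometricOn G U G' U' F) (hy : y ∈ U) (u v w t : E) :
    G' (F y) (curvatureMap G' (F y) (fderiv ℝ F y u) (fderiv ℝ F y v) (fderiv ℝ F y w))
        (fderiv ℝ F y t)
      + G' (F y) (acceleration G' F y v w) (acceleration G' F y u t)
      - G' (F y) (acceleration G' F y u w) (acceleration G' F y v t)
    = G y (curvatureMap G y u v w) t
      + G y (christoffelMap G y v w) (christoffelMap G y u t)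
      - G y (christoffelMap G y u w) (christoffelMap G y v t) := by
  have hcd := h.source.differentiableAt_christoffelMap hy
  -- This is `inner_acceleration` differentiated along `u`. Antisymmetrizing in `u`, `v` produces
  -- both curvatures.
  have key : ∀ u v, ∀ A' : E →L[ℝ] E', HasFDerivAt (fun z ↦ acceleration G' F z v w) A' y →
      G' (F y) (A' u + christoffelMap G' (F y) (fderiv ℝ F y u) (acceleration G' F y v w))
        (fderiv ℝ F y t)
        + G' (F y) (acceleration G' F y v w) (acceleration G' F y u t)
      = G y (fderiv ℝ (christoffelMap G) y u v w
          + christoffelMap G y u (christoffelMap G y v w)) t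
        + G y (christoffelMap G y v w) (christoffelMap G y u t) := by
    intro u v A' hA
    have h1 := h.target.fderiv_inner_along (h.mapsTo hy) (h.hasFDerivAt hy) hA
      (h.hasFDerivAt_fderiv_apply hy t) u
    have hX : HasFDerivAt (fun z ↦ christoffelMap G z v w)
        (fderiv ℝ (fun z ↦ christoffelMap G z v w) y) y :=
      ((hcd.clm_apply (differentiableAt_const v)).clm_apply (differentiableAt_const w)).hasFDerivAt
    have h2 := h.source.fderiv_inner_along (F := fun z ↦ z) hy (hasFDerivAt_id y) hX
      (hasFDerivAt_const t y) u
    have he : (fun z ↦ G' (F z) (acceleration G' F z v w) (fderiv ℝ F z t)) =ᶠ[𝓝 y]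
        fun z ↦ G z (christoffelMap G z v w) t := by
      filter_upwards [h.source.isOpen.mem_nhds hy] with z hz using h.inner_acceleration hz v w t
    rw [he.fderiv_eq, h2, fderiv_apply_const₂ hcd] at h1
    simp only [ContinuousLinearMap.coe_id', id_eq, zero_apply, zero_add] at h1
    rw [h1]
    rfl
  obtain ⟨A, hA, hA'⟩ := h.hasFDerivAt_acceleration hy v w
  obtain ⟨B, hB, hB'⟩ := h.hasFDerivAt_acceleration hy u w
  have k1 := key u v A hA
  have k2 := key v u B hB
  -- The third derivatives of `F` and the terms in `d²F(u, v)` are symmetric in `u`, `v` and drop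
  -- out.
  have hR : curvatureMap G' (F y) (fderiv ℝ F y u) (fderiv ℝ F y v) (fderiv ℝ F y w)
      = (A u + christoffelMap G' (F y) (fderiv ℝ F y u) (acceleration G' F y v w))
        - (B v + christoffelMap G' (F y) (fderiv ℝ F y v) (acceleration G' F y u w)) := by
    rw [hA', hB', ContDiffAt.fderiv_fderiv_comm (ContDiffAt.fderiv_top (h.contDiffAt hy)) u v,
      ContDiffAt.fderiv_fderiv_comm (h.contDiffAt hy) u v]
    simp only [curvatureMap, acceleration, map_add]
    abel
  rw [hR, map_sub, sub_apply]
  simp only [curvatureMap, map_add, map_sub, add_apply,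
    sub_apply] at k1 k2 ⊢
  linarith

/-- When `dF` is onto there are no normal directions, so the tangential part is everything. This is
the transformation law of Christoffel symbols under a change of charts. -/
theorem acceleration_eq_of_surjective (h : IsIsometricOn G U G' U' F) (hy : y ∈ U)
    (hs : Function.Surjective (fderiv ℝ F y)) (u v : E) :
    acceleration G' F y u v = fderiv ℝ F y (christoffelMap G y u v) :=
  h.target.eq_of_forall (h.mapsTo hy) fun w ↦ by
    obtain ⟨w, rfl⟩ := hs w
    rw [h.inner_acceleration hy, h.inner_eq y hy]

/-- The second fundamental form takes normal values. -/
theorem inner_acceleration_sub (h : IsIsometricOn G U G' U' F) (hy : y ∈ U) (u v w : E) :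
    G' (F y) (acceleration G' F y u v - fderiv ℝ F y (christoffelMap G y u v)) (fderiv ℝ F y w)
      = 0 := by
  rw [map_sub, sub_apply, h.inner_acceleration hy, h.inner_eq y hy, sub_self]

/-- The Gauss equation. -/
theorem gauss_sub (h : IsIsometricOn G U G' U' F) (hy : y ∈ U) (u v w t : E) :
    G y (curvatureMap G y u v w) t
      = G' (F y) (curvatureMap G' (F y) (fderiv ℝ F y u) (fderiv ℝ F y v) (fderiv ℝ F y w))
          (fderiv ℝ F y t)
      + G' (F y) (acceleration G' F y v w - fderiv ℝ F y (christoffelMap G y v w))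
          (acceleration G' F y u t - fderiv ℝ F y (christoffelMap G y u t))
      - G' (F y) (acceleration G' F y u w - fderiv ℝ F y (christoffelMap G y u w))
          (acceleration G' F y v t - fderiv ℝ F y (christoffelMap G y v t)) := by
  have h1 := h.gauss hy u v w t
  have h2 : ∀ a b c d, G' (F y) (acceleration G' F y a b - fderiv ℝ F y (christoffelMap G y a b))
      (acceleration G' F y c d - fderiv ℝ F y (christoffelMap G y c d))
      = G' (F y) (acceleration G' F y a b) (acceleration G' F y c d)
        - G y (christoffelMap G y a b) (christoffelMap G y c d) := by
    intro a b c d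
    rw [map_sub (G' (F y) (acceleration G' F y a b - fderiv ℝ F y (christoffelMap G y a b))),
      h.inner_acceleration_sub hy, map_sub, sub_apply,
      h.target.symm _ (fderiv ℝ F y (christoffelMap G y a b)), h.inner_acceleration hy,
      h.source.symm]
    ring
  rw [h2, h2]
  linarith

end IsIsometricOn

/-- Parallelism `∇J = 0` at `y` of a field of endomorphisms. -/
def IsParallelAt (G : E → E →L[ℝ] E →L[ℝ] ℝ) (J : E → E →L[ℝ] E) (y : E) : Prop :=
  ∀ u v, fderiv ℝ J y u v = J y (christoffelMap G y u v) - christoffelMap G y u (J y v)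

/-- The curvature commutes with a parallel endomorphism field. -/
theorem IsMetricOn.curvatureMap_parallel {G : E → E →L[ℝ] E →L[ℝ] ℝ} {U : Set E} {y : E}
    (hG : IsMetricOn G U) {J : E → E →L[ℝ] E} (hJ : ContDiffOn ℝ ∞ J U)
    (hp : ∀ z ∈ U, IsParallelAt G J z) (hy : y ∈ U) (u v w : E) :
    curvatureMap G y u v (J y w) = J y (curvatureMap G y u v w) := by
  have hJy : ContDiffAt ℝ ∞ J y := hJ.contDiffAt (hG.isOpen.mem_nhds hy)
  have hJd : HasFDerivAt J (fderiv ℝ J y) y := (hJy.differentiableAt (by simp)).hasFDerivAt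
  have hcd := (hG.differentiableAt_christoffelMap hy).hasFDerivAt
  -- Differentiate the parallelism equation along `u` and use it again to eliminate `∂J`. Symmetry
  -- of the second derivative of `J` is then exactly the commutation of `J` with the curvature.
  have key : ∀ u v, fderiv ℝ (fderiv ℝ J) y u v w
      = J y (christoffelMap G y u (christoffelMap G y v w))
        - christoffelMap G y u (J y (christoffelMap G y v w))
        + J y (fderiv ℝ (christoffelMap G) y u v w)
        - (fderiv ℝ (christoffelMap G) y u v (J y w)
          + christoffelMap G y v (J y (christoffelMap G y u w))
          - christoffelMap G y v (christoffelMap G y u (J y w))) := by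
    intro u v
    have he : (fun z ↦ fderiv ℝ J z v w) =ᶠ[𝓝 y]
        fun z ↦ J z (christoffelMap G z v w) - christoffelMap G z v (J z w) := by
      filter_upwards [hG.isOpen.mem_nhds hy] with z hz using hp z hz v w
    rw [← fderiv_apply_const₂ ((ContDiffAt.fderiv_top hJy).differentiableAt (by simp)),
      he.fderiv_eq]
    have hc1 := hcd.clm_apply (hasFDerivAt_const v y)
    have hd := ((hJd.clm_apply (hc1.clm_apply (hasFDerivAt_const w y))).fun_sub
      (hc1.clm_apply (hJd.clm_apply (hasFDerivAt_const w y)))).fderiv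
    rw [hd]
    simp [hp y hy _ _]
    abel
  have hc := congrArg (fun L ↦ L w) (ContDiffAt.fderiv_fderiv_comm hJy u v)
  simp only [key] at hc
  simp only [curvatureMap, map_add, map_sub]
  rw [← sub_eq_zero] at hc ⊢
  rw [← neg_eq_zero, ← hc]
  abel

/-- Parallelism is preserved by local isometries intertwining the endomorphism fields. -/
theorem IsIsometricOn.isParallelAt {G : E → E →L[ℝ] E →L[ℝ] ℝ} {U : Set E}
    {G' : E' → E' →L[ℝ] E' →L[ℝ] ℝ} {U' : Set E'} {F : E → E'} {y : E}
    (h : IsIsometricOn G U G' U' F) (hy : y ∈ U) (hs : Function.Surjective (fderiv ℝ F y))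
    {J : E → E →L[ℝ] E} {J' : E' → E' →L[ℝ] E'} (hJ : DifferentiableAt ℝ J y)
    (hJ' : DifferentiableAt ℝ J' (F y))
    (hcomm : ∀ z ∈ U, ∀ v, J' (F z) (fderiv ℝ F z v) = fderiv ℝ F z (J z v))
    (hp : IsParallelAt G J y) : IsParallelAt G' J' (F y) := by
  intro a b
  obtain ⟨u, rfl⟩ := hs a
  obtain ⟨w, rfl⟩ := hs b
  -- The intertwining relation is differentiated at `y`; the resulting second derivatives of `F` are
  -- absorbed by `acceleration_eq_of_surjective`.
  have he : (fun z ↦ J' (F z) (fderiv ℝ F z w)) =ᶠ[𝓝 y] fun z ↦ fderiv ℝ F z (J z w) := by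
    filter_upwards [h.source.isOpen.mem_nhds hy] with z hz using hcomm z hz w
  have h1 := congrArg (fun L : E →L[ℝ] E' ↦ L u) (he.fderiv_eq (𝕜 := ℝ))
  have hJF : HasFDerivAt (fun z ↦ J' (F z)) ((fderiv ℝ J' (F y)).comp (fderiv ℝ F y)) y :=
    hJ'.hasFDerivAt.comp y (h.hasFDerivAt hy)
  rw [(hJF.clm_apply (h.hasFDerivAt_fderiv_apply hy w)).fderiv,
    ((h.hasFDerivAt_fderiv hy).clm_apply
      (hJ.hasFDerivAt.clm_apply (hasFDerivAt_const w y))).fderiv] at h1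
  simp [hp u w] at h1
  have h2 := h.acceleration_eq_of_surjective hy hs u (J y w)
  have h3 := congrArg (J' (F y)) (h.acceleration_eq_of_surjective hy hs u w)
  rw [hcomm y hy] at h3
  simp only [acceleration, map_add] at h2 h3
  rw [← h2, ← h3] at h1
  rw [hcomm y hy]
  rw [← sub_eq_zero] at h1 ⊢
  rw [← h1]
  abel

/-- The cubic form of a Lagrangian immersion in a Kähler manifold is symmetric. -/
theorem IsIsometricOn.inner_acceleration_J {G : E → E →L[ℝ] E →L[ℝ] ℝ} {U : Set E}
    {G' : E' → E' →L[ℝ] E' →L[ℝ] ℝ} {U' : Set E'} {F : E → E'} {y : E}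
    (h : IsIsometricOn G U G' U' F) (hy : y ∈ U)
    {J' : E' → E' →L[ℝ] E'} (hJ' : DifferentiableAt ℝ J' (F y))
    (hp : IsParallelAt G' J' (F y))
    (hskew : ∀ a b, G' (F y) (J' (F y) a) b = -G' (F y) a (J' (F y) b))
    (hlag : ∀ z ∈ U, ∀ v w, G' (F z) (fderiv ℝ F z v) (J' (F z) (fderiv ℝ F z w)) = 0)
    (u v w : E) :
    G' (F y) (acceleration G' F y u v) (J' (F y) (fderiv ℝ F y w))
      = G' (F y) (acceleration G' F y u w) (J' (F y) (fderiv ℝ F y v)) := by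
  have hJF : HasFDerivAt (fun z ↦ J' (F z)) ((fderiv ℝ J' (F y)).comp (fderiv ℝ F y)) y :=
    hJ'.hasFDerivAt.comp y (h.hasFDerivAt hy)
  have h1 := h.fderiv_inner_fderiv hy (hJF.clm_apply (h.hasFDerivAt_fderiv_apply hy w)) u v
  -- Differentiate the Lagrangian condition `⟪dF v, J dF w⟫ = 0` along `u`: as `J` is parallel it
  -- passes through the covariant derivative, and skewness moves it to the other factor.
  have he : (fun z ↦ G' (F z) (fderiv ℝ F z v) (J' (F z) (fderiv ℝ F z w))) =ᶠ[𝓝 y]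
      fun _ ↦ (0 : ℝ) := by
    filter_upwards [h.source.isOpen.mem_nhds hy] with z hz using hlag z hz v w
  rw [he.fderiv_eq] at h1
  have h2 : ((J' (F y)).comp ((fderiv ℝ (fderiv ℝ F) y).flip w)
        + ((fderiv ℝ J' (F y)).comp (fderiv ℝ F y)).flip (fderiv ℝ F y w)) u
      + christoffelMap G' (F y) (fderiv ℝ F y u) (J' (F y) (fderiv ℝ F y w))
      = J' (F y) (acceleration G' F y u w) := by
    simp [hp _ _, acceleration]
    abel
  rw [h2, h.target.symm (F y) (fderiv ℝ F y v), hskew] at h1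
  simp at h1
  linarith

end LocalTheory

/-! ### Pointwise algebra: Kähler curvature tensors and the inequality for cubic forms. -/

section Algebra

/-- A Kähler curvature-like tensor of constant holomorphic sectional curvature `c` has sectional
curvature `c / 4` on totally real planes. -/
theorem totallyReal_curvature {V : Type*} [NormedAddCommGroup V] [InnerProductSpace ℝ V]
    (R : V → V → V → V → ℝ) (J : V → V) (c : ℝ)
    (hadd₁ : ∀ a a' b d e, R (a + a') b d e = R a b d e + R a' b d e)
    (hadd₃ : ∀ a b d d' e, R a b (d + d') e = R a b d e + R a b d' e)
    (h₁₂ : ∀ a b d e, R a b d e = -R b a d e)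
    (h₃₄ : ∀ a b d e, R a b d e = -R a b e d)
    (bianchi : ∀ a b d e, R a b d e + R b d a e + R d a b e = 0)
    (hRJ : ∀ a b d e, R a b (J d) (J e) = R a b d e)
    (hJadd : ∀ a b, J (a + b) = J a + J b) (hJneg : ∀ a, J (-a) = -J a)
    (hJJ : ∀ a, J (J a) = -a)
    (hJinner : ∀ a b, ⟪J a, J b⟫_ℝ = ⟪a, b⟫_ℝ)
    (hol : ∀ a, R a (J a) (J a) a = c * (‖a‖ ^ 2) ^ 2)
    {u v : V} (hu : ‖u‖ = 1) (hv : ‖v‖ = 1) (huv : ⟪u, v⟫_ℝ = 0) (hJuv : ⟪J u, v⟫_ℝ = 0) :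
    R u v v u = c / 4 := by
  have hadd₂ : ∀ a b b' d e, R a (b + b') d e = R a b d e + R a b' d e := fun a b b' d e ↦ by
    rw [h₁₂, hadd₁, h₁₂ a b, h₁₂ a b']; ring
  have hadd₄ : ∀ a b d e e', R a b d (e + e') = R a b d e + R a b d e' := fun a b d e e' ↦ by
    rw [h₃₄, hadd₃, h₃₄ a b d e, h₃₄ a b d e']; ring
  have hneg₁ : ∀ a b d e, R (-a) b d e = -R a b d e := fun a b d e ↦ by
    have h0 := hadd₁ 0 0 b d e
    have h1 := hadd₁ a (-a) b d e
    rw [add_neg_cancel] at h1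
    rw [add_zero] at h0
    linarith
  have hneg₃ : ∀ a b d e, R a b (-d) e = -R a b d e := fun a b d e ↦ by
    have h0 := hadd₃ a b 0 0 e
    have h1 := hadd₃ a b d (-d) e
    rw [add_neg_cancel] at h1
    rw [add_zero] at h0
    linarith
  have hneg₂ : ∀ a b d e, R a (-b) d e = -R a b d e := fun a b d e ↦ by
    rw [h₁₂, hneg₁, h₁₂ a b]
  have hneg₄ : ∀ a b d e, R a b d (-e) = -R a b d e := fun a b d e ↦ by
    rw [h₃₄, hneg₃, h₃₄ a b d e]
  -- Pair symmetry follows from the Bianchi identities for the four cyclic rotations of the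
  -- arguments and the two skew-symmetries.
  have pair : ∀ a b d e, R a b d e = R d e a b := fun a b d e ↦ by
    have b1 := bianchi a b d e
    have b2 := bianchi b d e a
    have b3 := bianchi d e a b
    have b4 := bianchi e a b d
    have := h₃₄ a b d e
    have := h₃₄ b d a e
    have := h₃₄ b d e a
    have := h₁₂ d a b e
    have := h₁₂ a d b e
    have := h₃₄ d a e b
    have := h₃₄ d a b e
    have := h₁₂ d e b a
    have := h₃₄ d e a b
    have := h₁₂ e b d a
    have := h₃₄ e b d a
    have := h₁₂ e a b d
    have := h₁₂ b e d a
    have := h₁₂ b e a d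
    have := h₃₄ e b a d
    have := h₃₄ e a d b
    have := h₃₄ e a b d
    have := h₁₂ a e d b
    have := h₁₂ a b e d
    have := h₁₂ a b d e
    have := h₃₄ a d e b
    linarith
  have hRJ₁ : ∀ a b d e, R (J a) (J b) d e = R a b d e := fun a b d e ↦ by
    rw [pair, hRJ, pair]
  -- Polarization of the holomorphic sectional curvature: adding the values at `a + b` and `a - b`
  -- leaves the even terms, which `J`-invariance and Bianchi reduce to the curvatures of `(a, b)`
  -- and `(a, J b)`.
  have key : ∀ a b, R (a + b) (J (a + b)) (J (a + b)) (a + b)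
      + R (a + -b) (J (a + -b)) (J (a + -b)) (a + -b)
      = 2 * R a (J a) (J a) a + 2 * R b (J b) (J b) b
        + 4 * R a b b a + 12 * R a (J b) (J b) a := by
    intro a b
    have e13 : R b (J a) (J b) a = R a (J b) (J b) a := by
      rw [← hRJ₁ b, hJJ, hneg₂, h₁₂ a]
    have e24 : R a (J b) (J a) b = R a (J b) (J b) a := by
      rw [← hRJ _ _ (J a), hJJ, hneg₃, h₃₄ _ _ (J b)]
    have e14 : R b (J a) (J a) b = R a (J b) (J b) a := by
      rw [← hRJ₁ b, hJJ, hneg₂, ← hRJ _ _ (J a), hJJ, hneg₃, h₁₂ a, h₃₄ _ _ (J b)]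
    have e34 : R a (J a) (J b) b = R a b b a + R a (J b) (J b) a := by
      have hb := bianchi a (J a) (J b) b
      have h1 : R (J a) (J b) a b = -R a b b a := by rw [hRJ₁, h₃₄]
      have h2 : R (J b) a (J a) b = -R a (J b) (J b) a := by rw [h₁₂, e24]
      linarith
    have e12 : R b (J b) (J a) a = R a b b a + R a (J b) (J b) a := by
      rw [pair, h₁₂, h₃₄, ← e34]; ring
    simp only [hJadd, hJneg, hadd₁, hadd₂, hadd₃, hadd₄, hneg₁, hneg₂, hneg₃, hneg₄]
    linarith
  have hJnorm : ∀ a, ‖J a‖ = ‖a‖ := fun a ↦ by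
    have := hJinner a a
    rw [real_inner_self_eq_norm_sq, real_inner_self_eq_norm_sq] at this
    exact (sq_eq_sq₀ (norm_nonneg _) (norm_nonneg _)).1 this
  -- Here `‖u ± v‖ ^ 2 = 2`, so the left side of `key` is `8 * c`. Applying the relation to `v` and
  -- to `J v` gives a linear system whose solution is `c / 4`.
  have main : ∀ v, ‖v‖ = 1 → ⟪u, v⟫_ℝ = 0 → R u v v u + 3 * R u (J v) (J v) u = c := by
    intro v hv huv
    have h := key u v
    simp only [hol, norm_add_sq_real, norm_neg, inner_neg_right, hu, hv, huv] at h
    linarith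
  have hJv : ⟪u, J v⟫_ℝ = 0 := by
    have := hJinner u (J v)
    rw [hJJ, inner_neg_right, hJuv] at this
    linarith
  have h1 := main v hv huv
  have h2 := main (J v) ((hJnorm v).trans hv) hJv
  rw [hJJ, hneg₂, hneg₃] at h2
  linarith

/-- The trace of a bilinear map does not depend on the orthonormal basis. -/
theorem sum_orthonormalBasis_eq {V W ι κ : Type*} [NormedAddCommGroup V] [InnerProductSpace ℝ V]
    [AddCommGroup W] [Module ℝ W] [Fintype ι] [Fintype κ]
    (e : OrthonormalBasis ι ℝ V) (f : OrthonormalBasis κ ℝ V) (B : V →ₗ[ℝ] V →ₗ[ℝ] W) :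
    ∑ i, B (e i) (e i) = ∑ k, B (f k) (f k) := by
  have h1 : ∀ i, B (e i) (e i) = ∑ k, ∑ l, (⟪f k, e i⟫_ℝ * ⟪f l, e i⟫_ℝ) • B (f k) (f l) := by
    intro i
    conv_lhs => rw [← f.sum_repr' (e i)]
    simp [map_sum, LinearMap.sum_apply, Finset.smul_sum, smul_smul]
    rw [Finset.sum_comm]
    simp [mul_comm]
  simp_rw [h1]
  rw [Finset.sum_comm]
  refine Finset.sum_congr rfl fun k _ ↦ ?_
  rw [Finset.sum_comm]
  simp_rw [← Finset.sum_smul]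
  have h2 : ∀ l, ∑ i, ⟪f k, e i⟫_ℝ * ⟪f l, e i⟫_ℝ = ⟪f k, f l⟫_ℝ := fun l ↦ by
    rw [← e.sum_inner_mul_inner (f k) (f l)]
    simp_rw [real_inner_comm (f l)]
  simp_rw [h2]
  rw [Finset.sum_eq_single k]
  · simp
  · intro l _ hl
    rw [f.orthonormal.2 hl.symm, zero_smul]
  · simp

/-- The quadratic form for `r = o`, with `m = n - 1`, `S` the sum of the entries, `P` the sum of
their squares and `a` the entry at `o`. The coefficient of `P - a ^ 2` is `-(3 / 2 - 1 / m) ≤ 0`, so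
Cauchy-Schwarz over the other `m` entries applies. The positive multiple of `S ^ 2` left over in
`h4` shows that this case is not the extremal one. -/
theorem quadratic_bound_same {m S P a : ℝ} (hm : 2 ≤ m) (hcs : (S - a) ^ 2 ≤ m * (P - a ^ 2)) :
    1 / 2 * S ^ 2 - 1 / m * a * S - 1 / 2 * P + 1 / m * a ^ 2 - (1 - 1 / m) * (P - a ^ 2)
      ≤ (3 * m + 2) * (m - 1) / (2 * (3 * m + 8) * m) * S ^ 2 := by
  have hm0 : 0 < m := by linarith
  have h1 : (S - a) ^ 2 / m ≤ P - a ^ 2 := by rw [div_le_iff₀ hm0]; linarith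
  have h2 : 0 ≤ 3 / 2 - 1 / m := by
    have : 1 / m ≤ 1 / 2 := one_div_le_one_div_of_le (by norm_num) hm
    linarith
  have h3 := mul_le_mul_of_nonneg_left h1 h2
  have h4 : (3 * m + 2) * (m - 1) / (2 * (3 * m + 8) * m) * S ^ 2
      - (1 / 2 * S ^ 2 - 1 / m * a * S - 1 / 2 * a ^ 2 + 1 / m * a ^ 2
        - (3 / 2 - 1 / m) * ((S - a) ^ 2 / m))
      = 2 * (m - 1) / ((3 * m + 8) * m * (m + 2)) * S ^ 2
        + (m - 1) * (m + 2) / (2 * m ^ 2) * (S - a - m * S / (m + 2)) ^ 2 := by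
    have : m + 2 ≠ 0 := by positivity
    have : 3 * m + 8 ≠ 0 := by positivity
    field_simp
    ring
  have h5 : 0 ≤ 2 * (m - 1) / ((3 * m + 8) * m * (m + 2)) * S ^ 2
      + (m - 1) * (m + 2) / (2 * m ^ 2) * (S - a - m * S / (m + 2)) ^ 2 := by
    have : 0 ≤ m - 1 := by linarith
    positivity
  linarith

/-- The quadratic form for `r ≠ o`, with `a`, `b` the entries at `o` and `r`. Cauchy-Schwarz runs
over the other `m - 1` entries. The gap in `h4` is a sum of two squares that can vanish together
with `S ≠ 0`; this is the origin of the factor `3 * m + 8`, that is `3 * n + 5`. -/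
theorem quadratic_bound_diff {m S P a b : ℝ} (hm : 2 ≤ m)
    (hcs : (S - a - b) ^ 2 ≤ (m - 1) * (P - a ^ 2 - b ^ 2)) :
    1 / 2 * S ^ 2 - 1 / m * a * S - 1 / 2 * P + 1 / m * a ^ 2 - (P - b ^ 2 - 1 / m * a ^ 2)
      ≤ (3 * m + 2) * (m - 1) / (2 * (3 * m + 8) * m) * S ^ 2 := by
  obtain ⟨k, rfl⟩ : ∃ k, m = k + 1 := ⟨m - 1, by ring⟩
  have hk : 0 < k := by linarith
  have h1 : (S - a - b) ^ 2 / k ≤ P - a ^ 2 - b ^ 2 := by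
    rw [div_le_iff₀ hk]; linarith
  have h4 : (3 * (k + 1) + 2) * (k + 1 - 1) / (2 * (3 * (k + 1) + 8) * (k + 1)) * S ^ 2
      - (1 / 2 * S ^ 2 - 1 / (k + 1) * a * S + 1 / (k + 1) * a ^ 2
        - (a ^ 2 - 1 / (k + 1) * a ^ 2) - 1 / 2 * (a ^ 2 + b ^ 2)
        - 3 / 2 * ((S - a - b) ^ 2 / k))
      = 2 * k / (k + 1) * (a - (k / (k + 1) * S - (S - a - b)) * (k + 1) / (4 * k)) ^ 2
        + (3 * k + 11) / (8 * k) * (S - a - b - 3 * k * S / (3 * k + 11)) ^ 2 := by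
    have : k + 1 ≠ 0 := by positivity
    have : 3 * k + 11 ≠ 0 := by positivity
    have : 3 * (k + 1) + 8 ≠ 0 := by positivity
    field_simp
    ring
  have h5 : 0 ≤ 2 * k / (k + 1) * (a - (k / (k + 1) * S - (S - a - b)) * (k + 1) / (4 * k)) ^ 2
        + (3 * k + 11) / (8 * k) * (S - a - b - 3 * k * S / (3 * k + 11)) ^ 2 := by
    positivity
  linarith

variable {ι : Type*} [Fintype ι] [DecidableEq ι]

theorem sq_sub_one_le (a : ι → ℝ) (o : ι) :
    (∑ i, a i - a o) ^ 2 ≤ ((Fintype.card ι : ℝ) - 1) * (∑ i, a i ^ 2 - a o ^ 2) := by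
  have h := sq_sum_le_card_mul_sum_sq (s := Finset.univ.erase o) (f := a)
  rw [Finset.sum_erase_eq_sub (Finset.mem_univ o), Finset.sum_erase_eq_sub (Finset.mem_univ o),
    Finset.card_erase_of_mem (Finset.mem_univ o), Finset.card_univ,
    Nat.cast_sub (Fintype.card_pos_iff.2 ⟨o⟩)] at h
  simpa using h

theorem sq_sub_two_le (a : ι → ℝ) {o r : ι} (hr : r ≠ o) :
    (∑ i, a i - a o - a r) ^ 2
      ≤ ((Fintype.card ι : ℝ) - 1 - 1) * (∑ i, a i ^ 2 - a o ^ 2 - a r ^ 2) := by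
  have hmem : r ∈ Finset.univ.erase o := by simp [hr]
  have h := sq_sum_le_card_mul_sum_sq (s := (Finset.univ.erase o).erase r) (f := a)
  have hcard : 1 ≤ (Finset.univ.erase o).card := Finset.card_pos.2 ⟨r, hmem⟩
  rw [Finset.sum_erase_eq_sub hmem, Finset.sum_erase_eq_sub hmem,
    Finset.sum_erase_eq_sub (Finset.mem_univ o), Finset.sum_erase_eq_sub (Finset.mem_univ o),
    Finset.card_erase_of_mem hmem, Nat.cast_sub hcard,
    Finset.card_erase_of_mem (Finset.mem_univ o), Finset.card_univ,
    Nat.cast_sub (Fintype.card_pos_iff.2 ⟨o⟩)] at h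
  simpa using h

/-- The inequality between the intrinsic and extrinsic invariants for a symmetric cubic form. -/
theorem symmetric_cubic_bound (hn : 3 ≤ Fintype.card ι) (o : ι) (σ : ι → ι → ι → ℝ)
    (h₁₂ : ∀ i j k, σ i j k = σ j i k) (h₂₃ : ∀ i j k, σ i j k = σ i k j)
    {m : ℝ} (hm : m = (Fintype.card ι : ℝ) - 1) :
    1 / 2 * ∑ i, ∑ j, ∑ r, (σ i i r * σ j j r - σ i j r ^ 2)
        - 1 / m * ∑ j, ∑ r, (σ o o r * σ j j r - σ o j r ^ 2)
      ≤ (3 * m + 2) * (m - 1) / (2 * (3 * m + 8) * m) * ∑ r, (∑ i, σ i i r) ^ 2 := by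
  have hm2 : 2 ≤ m := by
    have : (3 : ℝ) ≤ Fintype.card ι := by exact_mod_cast hn
    linarith
  have hinv : 1 / m ≤ 1 / 2 := one_div_le_one_div_of_le (by norm_num) hm2
  set μ := 1 / m with hμ
  have hμ0 : 0 ≤ μ := by rw [hμ]; positivity
  -- Half of the Ricci term is charged to row `o` and half to column `o`, making the left side `1 /
  -- 2 * ∑ w i j * κ i j`. Nonnegativity of `w`, which permits termwise estimates, uses `μ ≤ 1 / 2`
  -- at the entry `(o, o)`.
  let w : ι → ι → ℝ := fun i j ↦ 1 - (if i = o then μ else 0) - (if j = o then μ else 0)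
  have hw : ∀ i j, 0 ≤ w i j := by
    intro i j
    simp only [w]
    split_ifs <;> linarith
  have hwsymm : ∀ i j, w i j = w j i := fun i j ↦ by simp only [w]; ring
  have hwsum : ∀ f : ι → ι → ℝ, (∀ i j, f i j = f j i) →
      1 / 2 * ∑ i, ∑ j, w i j * f i j = 1 / 2 * ∑ i, ∑ j, f i j - μ * ∑ j, f o j := by
    intro f hf
    have h1 : ∑ i, ∑ j, (if i = o then μ else 0) * f i j = μ * ∑ j, f o j := by
      simp_rw [← Finset.mul_sum]
      simp
    have h2 : ∑ i, ∑ j, (if j = o then μ else 0) * f i j = μ * ∑ j, f o j := by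
      simp [Finset.mul_sum, hf o]
    simp only [w, sub_mul, one_mul, Finset.sum_sub_distrib, h1, h2]
    ring
  let A : ι → ι → ℝ := fun r i ↦ σ i i r
  -- For `i ≠ j` only the squares with `r = i` or `r = j` are kept; symmetry of `σ` turns them into
  -- `A j i ^ 2` and `A i j ^ 2`. On the diagonal nothing is lost.
  have hkappa : ∀ i j, ∑ r, (σ i i r * σ j j r - σ i j r ^ 2)
      ≤ ∑ r, A r i * A r j
        - (if i = j then ∑ r, A r i ^ 2 else A j i ^ 2 + A i j ^ 2) := by
    intro i j
    rw [Finset.sum_sub_distrib]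
    refine sub_le_sub_left ?_ _
    split_ifs with hij
    · subst hij; exact le_rfl
    · have h := Finset.sum_le_sum_of_subset_of_nonneg (f := fun r ↦ σ i j r ^ 2)
        (Finset.subset_univ {i, j}) (fun _ _ _ ↦ sq_nonneg _)
      rw [Finset.sum_pair hij] at h
      have e1 : A j i = σ i j i := h₂₃ i i j
      have e2 : A i j = σ i j j := by rw [h₁₂ i j j]; exact h₂₃ j j i
      rw [e1, e2]; exact h
  have hr : ∀ r, 1 / 2 * ((∑ i, A r i) ^ 2) - μ * A r o * ∑ i, A r i
      - (1 / 2 * ∑ i, A r i ^ 2 - μ * A r o ^ 2)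
      - (∑ j, w r j * A r j ^ 2 - w r r * A r r ^ 2)
      ≤ (3 * m + 2) * (m - 1) / (2 * (3 * m + 8) * m) * (∑ i, A r i) ^ 2 := by
    intro r
    have hwr : ∑ j, w r j * A r j ^ 2
        = (1 - (if r = o then μ else 0)) * ∑ j, A r j ^ 2 - μ * A r o ^ 2 := by
      simp only [w, sub_mul _ (if _ = o then μ else 0 : ℝ) (_ ^ 2), Finset.sum_sub_distrib,
        ← Finset.mul_sum]
      simp [sub_mul]
    rw [hwr]
    by_cases hro : r = o
    · subst hro
      have := quadratic_bound_same hm2 (hm ▸ sq_sub_one_le (A r) r)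
      simp only [w, if_true]
      rw [← hμ] at this
      linarith
    · have := quadratic_bound_diff hm2 (hm ▸ sq_sub_two_le (A r) hro)
      simp only [w, if_neg hro]
      rw [← hμ] at this
      linarith
  have hsum := Finset.sum_le_sum fun r (_ : r ∈ Finset.univ) ↦ hr r
  rw [← Finset.mul_sum] at hsum
  refine le_trans ?_ hsum
  rw [← hwsum (fun i j ↦ ∑ r, (σ i i r * σ j j r - σ i j r ^ 2)) (fun i j ↦
    Finset.sum_congr rfl fun r _ ↦ by rw [h₁₂ i j r]; ring)]
  have h1 : ∑ i, ∑ j, w i j * ∑ r, (σ i i r * σ j j r - σ i j r ^ 2)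
      ≤ ∑ i, ∑ j, w i j * (∑ r, A r i * A r j
        - (if i = j then ∑ r, A r i ^ 2 else A j i ^ 2 + A i j ^ 2)) :=
    Finset.sum_le_sum fun i _ ↦ Finset.sum_le_sum fun j _ ↦
      mul_le_mul_of_nonneg_left (hkappa i j) (hw i j)
  have h2 : 1 / 2 * ∑ i, ∑ j, w i j * (∑ r, A r i * A r j)
      = ∑ r, (1 / 2 * ((∑ i, A r i) ^ 2) - μ * A r o * ∑ i, A r i) := by
    rw [hwsum _ (fun i j ↦ Finset.sum_congr rfl fun r _ ↦ mul_comm _ _), Finset.sum_sub_distrib,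
      ← Finset.mul_sum]
    congr 1
    · congr 1
      simp_rw [sq, Finset.sum_mul_sum]
      conv_rhs => rw [Finset.sum_comm]
      exact Finset.sum_congr rfl fun i _ ↦ Finset.sum_comm
    · rw [Finset.sum_comm, Finset.mul_sum]
      exact Finset.sum_congr rfl fun r _ ↦ by rw [← Finset.mul_sum, mul_assoc]
  have h3 : ∀ i, ∑ j, w i j * (if i = j then ∑ r, A r i ^ 2 else A j i ^ 2 + A i j ^ 2)
      = w i i * ∑ r, A r i ^ 2 + (∑ j, w i j * (A j i ^ 2 + A i j ^ 2)
        - w i i * (A i i ^ 2 + A i i ^ 2)) := by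
    intro i
    rw [← Finset.add_sum_erase _ _ (Finset.mem_univ i), if_pos rfl,
      ← Finset.sum_erase_eq_sub (Finset.mem_univ i)]
    congr 1
    refine Finset.sum_congr rfl fun j hj ↦ ?_
    rw [if_neg (Finset.ne_of_mem_erase hj).symm]
  have h4 : ∑ i, w i i * ∑ r, A r i ^ 2 = ∑ r, (∑ i, A r i ^ 2 - 2 * (μ * A r o ^ 2)) := by
    simp_rw [Finset.mul_sum]
    rw [Finset.sum_comm]
    refine Finset.sum_congr rfl fun r _ ↦ ?_
    have : ∀ i, w i i * A r i ^ 2 = A r i ^ 2 - 2 * ((if i = o then μ else 0) * A r i ^ 2) :=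
      fun i ↦ by simp only [w]; ring
    simp_rw [this]
    rw [Finset.sum_sub_distrib, ← Finset.mul_sum]
    simp
  have h5 : ∑ i, ∑ j, w i j * A j i ^ 2 = ∑ i, ∑ j, w i j * A i j ^ 2 := by
    rw [Finset.sum_comm]
    exact Finset.sum_congr rfl fun i _ ↦ Finset.sum_congr rfl fun j _ ↦ by rw [hwsymm]
  -- The squares `A j i ^ 2` and `A i j ^ 2` have equal weighted sums, which cancels the factor `1 /
  -- 2`; everything is now indexed by the normal direction `r`, as in `hr`.
  have h6 : 1 / 2 * ∑ i, ∑ j,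
        w i j * (if i = j then ∑ r, A r i ^ 2 else A j i ^ 2 + A i j ^ 2)
      = ∑ r, ((1 / 2 * ∑ i, A r i ^ 2 - μ * A r o ^ 2)
        + (∑ j, w r j * A r j ^ 2 - w r r * A r r ^ 2)) := by
    simp_rw [h3]
    simp only [mul_add, Finset.sum_add_distrib, Finset.sum_sub_distrib, h4, h5,
      ← Finset.mul_sum]
    ring
  simp_rw [mul_sub, Finset.sum_sub_distrib] at h1
  simp only [Finset.sum_sub_distrib, Finset.sum_add_distrib, mul_sub] at h2 h6 h1 ⊢
  linarith

end Algebra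

/-! ### Passage from the manifold to its preferred charts. -/

section Charts

variable {E : Type*} [NormedAddCommGroup E] [NormedSpace ℝ E]
  {M : Type*} [TopologicalSpace M] [ChartedSpace E M] [IsManifold 𝓘(ℝ, E) ∞ M]

theorem extChartAt_target_isOpen (p : M) : IsOpen (extChartAt 𝓘(ℝ, E) p).target :=
  isOpen_extChartAt_target p

theorem extChartAt_symm_mem {p : M} {z : E} (hz : z ∈ (extChartAt 𝓘(ℝ, E) p).target) :
    (extChartAt 𝓘(ℝ, E) p).symm z ∈ (chartAt E p).source := by
  simpa using (extChartAt 𝓘(ℝ, E) p).map_target hz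

theorem extChartAt_mem_target {p q : M} (hq : q ∈ (chartAt E p).source) :
    extChartAt 𝓘(ℝ, E) p q ∈ (extChartAt 𝓘(ℝ, E) p).target :=
  (extChartAt 𝓘(ℝ, E) p).map_source (by simpa using hq)

theorem extChartAt_symm_extChartAt {p q : M} (hq : q ∈ (chartAt E p).source) :
    (extChartAt 𝓘(ℝ, E) p).symm (extChartAt 𝓘(ℝ, E) p q) = q :=
  (extChartAt 𝓘(ℝ, E) p).left_inv (by simpa using hq)

/-- The coordinate vector fields of a chart are smooth. -/
theorem contMDiffOn_ofCoord (p : M) (u : E) :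
    ContMDiffOn 𝓘(ℝ, E) (𝓘(ℝ, E).prod 𝓘(ℝ, E)) ∞
      (fun q ↦ TotalSpace.mk' E (E := fun q : M ↦ TangentSpace 𝓘(ℝ, E) q) q (ofCoord p q u))
      (chartAt E p).source := by
  let e := trivializationAt E (fun q : M ↦ TangentSpace 𝓘(ℝ, E) q) p
  have hb : e.baseSet = (chartAt E p).source := by simp [e]
  rw [← hb, e.contMDiffOn_section_baseSet_iff]
  refine (contMDiffOn_const (c := u)).congr fun q hq ↦ ?_
  have h1 := toCoord_ofCoord (hb ▸ hq) u
  have h2 : toCoord p q (ofCoord p q u) = (e ⟨q, ofCoord p q u⟩).2 := by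
    change e.continuousLinearMapAt ℝ q _ = _
    rw [Bundle.Trivialization.continuousLinearMapAt_apply, e.coe_linearMapAt_of_mem hq]
  rw [← h2, h1]

theorem endCoord_apply (J : ∀ p : M, TangentSpace 𝓘(ℝ, E) p →L[ℝ] TangentSpace 𝓘(ℝ, E) p)
    {p q : M} (hq : q ∈ (chartAt E p).source) (u : E) :
    endCoord J p (extChartAt 𝓘(ℝ, E) p q) u = toCoord p q (J q (ofCoord p q u)) :=
  congrArg (fun q ↦ toCoord p q (J q (ofCoord p q u))) (extChartAt_symm_extChartAt hq)

theorem contDiffOn_endCoord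
    {J : ∀ p : M, TangentSpace 𝓘(ℝ, E) p →L[ℝ] TangentSpace 𝓘(ℝ, E) p}
    (hJ : ContMDiff 𝓘(ℝ, E) (𝓘(ℝ, E).prod 𝓘(ℝ, E →L[ℝ] E)) ∞
      (fun p ↦ TotalSpace.mk' (E →L[ℝ] E)
        (E := fun p : M ↦ TangentSpace 𝓘(ℝ, E) p →L[ℝ] TangentSpace 𝓘(ℝ, E) p) p (J p)))
    (p : M) : ContDiffOn ℝ ∞ (endCoord J p) (extChartAt 𝓘(ℝ, E) p).target := by
  let e := trivializationAt (E →L[ℝ] E)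
    (fun p : M ↦ TangentSpace 𝓘(ℝ, E) p →L[ℝ] TangentSpace 𝓘(ℝ, E) p) p
  have hb : e.baseSet = (chartAt E p).source := by
    simp [e]
  have h1 := (e.contMDiffOn_section_baseSet_iff).1 (hJ.contMDiffOn (s := e.baseSet))
  rw [hb] at h1
  rw [← contMDiffOn_iff_contDiffOn]
  exact h1.comp (contMDiffOn_extChartAt_symm p) fun z hz ↦ extChartAt_symm_mem hz

variable [RiemannianBundle (fun x : M ↦ TangentSpace 𝓘(ℝ, E) x)]

theorem metricCoord_apply {p q : M} (hq : q ∈ (chartAt E p).source) (u v : E) :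
    metricCoord p (extChartAt 𝓘(ℝ, E) p q) u v = ⟪ofCoord p q u, ofCoord p q v⟫_ℝ :=
  congrArg (fun q ↦ ⟪ofCoord p q u, ofCoord p q v⟫_ℝ) (extChartAt_symm_extChartAt hq)

theorem metricCoord_toCoord {p q : M} (hq : q ∈ (chartAt E p).source)
    (u v : TangentSpace 𝓘(ℝ, E) q) :
    metricCoord p (extChartAt 𝓘(ℝ, E) p q) (toCoord p q u) (toCoord p q v) = ⟪u, v⟫_ℝ := by
  rw [metricCoord_apply hq, ofCoord_toCoord hq, ofCoord_toCoord hq]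

theorem christoffel_eq (p : M) (y u v : E) :
    christoffel p y u v = christoffelMap (metricCoord p) y u v := by
  rfl

variable [FiniteDimensional ℝ E]

theorem isMetricOn_metricCoord [IsContMDiffRiemannianBundle 𝓘(ℝ, E) ∞ E
    (fun x : M ↦ TangentSpace 𝓘(ℝ, E) x)] (p : M) :
    IsMetricOn (metricCoord p) (extChartAt 𝓘(ℝ, E) p).target where
  isOpen := extChartAt_target_isOpen p
  contDiffOn := by
    rw [contDiffOn_clm_apply]
    intro u
    rw [contDiffOn_clm_apply]
    intro v
    rw [← contMDiffOn_iff_contDiffOn]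
    have h : ContMDiffOn 𝓘(ℝ, E) 𝓘(ℝ) ∞ (fun q : M ↦ ⟪ofCoord p q u, ofCoord p q v⟫_ℝ)
        (chartAt E p).source := by
      refine ContMDiffOn.inner_bundle (F := E) (IB := 𝓘(ℝ, E))
        (E := fun x : M ↦ TangentSpace 𝓘(ℝ, E) x) (b := fun x ↦ x) ?_ ?_
      · exact contMDiffOn_ofCoord p u
      · exact contMDiffOn_ofCoord p v
    exact h.comp (contMDiffOn_extChartAt_symm p) fun z hz ↦ extChartAt_symm_mem hz
  symm z u v := by
    change ⟪ofCoord p _ u, ofCoord p _ v⟫_ℝ = ⟪ofCoord p _ v, ofCoord p _ u⟫_ℝ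
    rw [real_inner_comm]
  pos z hz u hu := by
    change 0 < ⟪ofCoord p _ u, ofCoord p _ u⟫_ℝ
    refine real_inner_self_pos.2 fun h ↦ hu ?_
    rw [← toCoord_ofCoord (extChartAt_symm_mem hz) u, h, map_zero]

theorem curvatureCoord_eq [IsContMDiffRiemannianBundle 𝓘(ℝ, E) ∞ E
    (fun x : M ↦ TangentSpace 𝓘(ℝ, E) x)] (p : M) {y : E}
    (hy : y ∈ (extChartAt 𝓘(ℝ, E) p).target) (u v w : E) :
    curvatureCoord p y u v w = curvatureMap (metricCoord p) y u v w := by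
  have h := (isMetricOn_metricCoord p).differentiableAt_christoffelMap hy
  simp only [curvatureCoord, christoffel_eq, curvatureMap]
  rw [fderiv_apply_const₂ h, fderiv_apply_const₂ h]

theorem inner_curvature [IsContMDiffRiemannianBundle 𝓘(ℝ, E) ∞ E
    (fun x : M ↦ TangentSpace 𝓘(ℝ, E) x)] (p : M) (u v w t : TangentSpace 𝓘(ℝ, E) p) :
    ⟪curvature p u v w, t⟫_ℝ = metricCoord p (extChartAt 𝓘(ℝ, E) p p)
      (curvatureMap (metricCoord p) (extChartAt 𝓘(ℝ, E) p p)
        (toCoord p p u) (toCoord p p v) (toCoord p p w)) (toCoord p p t) := by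
  have hp := mem_chart_source E p
  rw [← metricCoord_toCoord hp, curvature, toCoord_ofCoord hp,
    curvatureCoord_eq p (extChartAt_mem_target hp)]

end Charts

/-! ### Maps between manifolds read in charts, and changes of charts. -/

section Immersions

variable {E : Type*} [NormedAddCommGroup E] [NormedSpace ℝ E] [FiniteDimensional ℝ E]
  {M : Type*} [TopologicalSpace M] [ChartedSpace E M] [IsManifold 𝓘(ℝ, E) ∞ M]
  [RiemannianBundle (fun x : M ↦ TangentSpace 𝓘(ℝ, E) x)]
  {E' : Type*} [NormedAddCommGroup E'] [NormedSpace ℝ E'] [FiniteDimensional ℝ E']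
  {M' : Type*} [TopologicalSpace M'] [ChartedSpace E' M'] [IsManifold 𝓘(ℝ, E') ∞ M']
  [RiemannianBundle (fun x : M' ↦ TangentSpace 𝓘(ℝ, E') x)]

variable (E E') in
/-- The map `f` read in the preferred charts at `p` and `p'`. -/
def coordMap (f : M → M') (p : M) (p' : M') : E → E' :=
  extChartAt 𝓘(ℝ, E') p' ∘ f ∘ (extChartAt 𝓘(ℝ, E) p).symm

variable (E E') in
/-- The domain of `coordMap f p p'`. -/
def coordDomain (f : M → M') (p : M) (p' : M') : Set E :=
  (extChartAt 𝓘(ℝ, E) p).target ∩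
    (extChartAt 𝓘(ℝ, E) p).symm ⁻¹' (f ⁻¹' (chartAt E' p').source)

theorem isOpen_coordDomain {f : M → M'} (hf : Continuous f) (p : M) (p' : M') :
    IsOpen (coordDomain E E' f p p') :=
  (continuousOn_extChartAt_symm p).isOpen_inter_preimage (extChartAt_target_isOpen p)
    ((chartAt E' p').open_source.preimage hf)

theorem extChartAt_mem_coordDomain {f : M → M'} {p q : M} {p' : M'}
    (hq : q ∈ (chartAt E p).source) (hfq : f q ∈ (chartAt E' p').source) :
    extChartAt 𝓘(ℝ, E) p q ∈ coordDomain E E' f p p' := by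
  refine ⟨extChartAt_mem_target hq, ?_⟩
  simp only [Set.mem_preimage]
  rwa [extChartAt_symm_extChartAt hq]

theorem exists_of_mem_coordDomain {f : M → M'} {p : M} {p' : M'} {z : E}
    (hz : z ∈ coordDomain E E' f p p') :
    ∃ q ∈ (chartAt E p).source, f q ∈ (chartAt E' p').source ∧ extChartAt 𝓘(ℝ, E) p q = z :=
  ⟨_, extChartAt_symm_mem hz.1, hz.2, (extChartAt 𝓘(ℝ, E) p).right_inv hz.1⟩

theorem coordMap_extChartAt (f : M → M') {p q : M} {p' : M'} (hq : q ∈ (chartAt E p).source) :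
    coordMap E E' f p p' (extChartAt 𝓘(ℝ, E) p q) = extChartAt 𝓘(ℝ, E') p' (f q) := by
  simp only [coordMap, Function.comp_apply]
  rw [extChartAt_symm_extChartAt hq]

theorem contDiffOn_coordMap {f : M → M'} (hf : ContMDiff 𝓘(ℝ, E) 𝓘(ℝ, E') ∞ f) (p : M) (p' : M') :
    ContDiffOn ℝ ∞ (coordMap E E' f p p') (coordDomain E E' f p p') := by
  rw [← contMDiffOn_iff_contDiffOn]
  refine (contMDiffOn_extChartAt (x := p')).comp
    (hf.comp_contMDiffOn ((contMDiffOn_extChartAt_symm p).mono Set.inter_subset_left))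
    fun z hz ↦ hz.2

/-- The derivative of `f` read in charts is the differential of `f` read in charts. -/
theorem fderiv_coordMap {f : M → M'} (hf : ContMDiff 𝓘(ℝ, E) 𝓘(ℝ, E') ∞ f) {p q : M} {p' : M'}
    (hq : q ∈ (chartAt E p).source) (hfq : f q ∈ (chartAt E' p').source)
    (u : TangentSpace 𝓘(ℝ, E) q) :
    fderiv ℝ (coordMap E E' f p p') (extChartAt 𝓘(ℝ, E) p q) (toCoord p q u)
      = toCoord p' (f q) (mfderiv 𝓘(ℝ, E) 𝓘(ℝ, E') f q u) := by
  have h1 : HasMFDerivAt 𝓘(ℝ, E) 𝓘(ℝ, E) (extChartAt 𝓘(ℝ, E) p) q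
      (mfderiv 𝓘(ℝ, E) 𝓘(ℝ, E) (extChartAt 𝓘(ℝ, E) p) q) :=
    (mdifferentiableAt_extChartAt hq).hasMFDerivAt
  have h2 : HasMFDerivAt 𝓘(ℝ, E') 𝓘(ℝ, E') (extChartAt 𝓘(ℝ, E') p') (f q)
      (mfderiv 𝓘(ℝ, E') 𝓘(ℝ, E') (extChartAt 𝓘(ℝ, E') p') (f q)) :=
    (mdifferentiableAt_extChartAt hfq).hasMFDerivAt
  have h3 : HasMFDerivAt 𝓘(ℝ, E) 𝓘(ℝ, E') f q (mfderiv 𝓘(ℝ, E) 𝓘(ℝ, E') f q) :=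
    ((hf q).mdifferentiableAt (by simp)).hasMFDerivAt
  have hz := extChartAt_mem_coordDomain (f := f) hq hfq
  have h4 : HasFDerivAt (coordMap E E' f p p')
      (fderiv ℝ (coordMap E E' f p p') (extChartAt 𝓘(ℝ, E) p q)) (extChartAt 𝓘(ℝ, E) p q) :=
    (((contDiffOn_coordMap hf p p').contDiffAt
      ((isOpen_coordDomain hf.continuous p p').mem_nhds hz)).differentiableAt (by simp)).hasFDerivAt
  have h5 := h4.hasMFDerivAt.comp q h1
  have h6 := h2.comp q h3
  have h7 : (coordMap E E' f p p') ∘ (extChartAt 𝓘(ℝ, E) p)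
      =ᶠ[𝓝 q] (extChartAt 𝓘(ℝ, E') p') ∘ f := by
    filter_upwards [(chartAt E p).open_source.mem_nhds hq] with r hr using coordMap_extChartAt f hr
  have h8 := hasMFDerivAt_unique h5 (h6.congr_of_eventuallyEq h7)
  have h9 := congrArg (fun L ↦ L u) h8
  rw [toCoord_eq_mfderiv hq, toCoord_eq_mfderiv hfq]
  exact h9

/-- The bridge to the local theory. The two charts are arbitrary, so it covers changes of charts
too, by taking `f = id`. -/
theorem isIsometricOn_coordMap
    [IsContMDiffRiemannianBundle 𝓘(ℝ, E) ∞ E (fun x : M ↦ TangentSpace 𝓘(ℝ, E) x)]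
    [IsContMDiffRiemannianBundle 𝓘(ℝ, E') ∞ E' (fun x : M' ↦ TangentSpace 𝓘(ℝ, E') x)]
    {f : M → M'} (hf : IsIsometricImmersion E E' f) (p : M) (p' : M') :
    IsIsometricOn (metricCoord p) (coordDomain E E' f p p') (metricCoord p')
      (extChartAt 𝓘(ℝ, E') p').target (coordMap E E' f p p') where
  source :=
    { isOpen := isOpen_coordDomain hf.contMDiff.continuous p p'
      contDiffOn := (isMetricOn_metricCoord p).contDiffOn.mono Set.inter_subset_left
      symm := (isMetricOn_metricCoord p).symm
      pos := fun z hz ↦ (isMetricOn_metricCoord p).pos z hz.1 }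
  target := isMetricOn_metricCoord p'
  contDiffOn := contDiffOn_coordMap hf.contMDiff p p'
  mapsTo z hz := extChartAt_mem_target hz.2
  inner_eq z hz u v := by
    obtain ⟨q, hq, hfq, rfl⟩ := exists_of_mem_coordDomain hz
    rw [← toCoord_ofCoord hq u, ← toCoord_ofCoord hq v, fderiv_coordMap hf.contMDiff hq hfq,
      fderiv_coordMap hf.contMDiff hq hfq, coordMap_extChartAt f hq, metricCoord_toCoord hfq,
      hf.inner_mfderiv, metricCoord_toCoord hq]

theorem isIsometricImmersion_id : IsIsometricImmersion E E (id : M → M) where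
  contMDiff := contMDiff_id
  inner_mfderiv x u v := by rw [mfderiv_id]; rfl

/-- The endomorphism field of a Kähler structure is parallel at all points of a chart. -/
theorem IsKahler.isParallelAt
    [IsContMDiffRiemannianBundle 𝓘(ℝ, E) ∞ E (fun x : M ↦ TangentSpace 𝓘(ℝ, E) x)]
    {J : ∀ p : M, TangentSpace 𝓘(ℝ, E) p →L[ℝ] TangentSpace 𝓘(ℝ, E) p} (hJ : IsKahler J)
    (p : M) {z : E} (hz : z ∈ (extChartAt 𝓘(ℝ, E) p).target) :
    IsParallelAt (metricCoord p) (endCoord J p) z := by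
  -- `IsKahler.parallel` speaks only of the centre of each preferred chart. Parallelism at `z` is
  -- obtained at the centre of the chart at `q` and carried over by the change of charts, a local
  -- isometry.
  set q := (extChartAt 𝓘(ℝ, E) p).symm z
  have hqp : q ∈ (chartAt E p).source := extChartAt_symm_mem hz
  have hqq := mem_chart_source E q
  have hzq : extChartAt 𝓘(ℝ, E) p q = z := (extChartAt 𝓘(ℝ, E) p).right_inv hz
  have hiso := isIsometricOn_coordMap (isIsometricImmersion_id (E := E) (M := M)) q p
  have hy : extChartAt 𝓘(ℝ, E) q q ∈ coordDomain E E (id : M → M) q p :=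
    extChartAt_mem_coordDomain hqq hqp
  have hF : coordMap E E id q p (extChartAt 𝓘(ℝ, E) q q) = z := by
    rw [coordMap_extChartAt id hqq]; exact hzq
  have hder : ∀ r ∈ (chartAt E q).source, r ∈ (chartAt E p).source →
      ∀ u : TangentSpace 𝓘(ℝ, E) r,
      fderiv ℝ (coordMap E E id q p) (extChartAt 𝓘(ℝ, E) q r) (toCoord q r u) = toCoord p r u := by
    intro r hr hr' u
    rw [fderiv_coordMap contMDiff_id hr hr', mfderiv_id]
    rfl
  rw [← hF]
  refine hiso.isParallelAt hy (J := endCoord J q) ?_ ?_ ?_ ?_ ?_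
  · intro a
    refine ⟨toCoord q q (ofCoord p q a), ?_⟩
    rw [hder q hqq hqp, toCoord_ofCoord hqp]
  · exact ((contDiffOn_endCoord hJ.contMDiff q).contDiffAt
      ((extChartAt_target_isOpen q).mem_nhds hy.1)).differentiableAt (by simp)
  · rw [hF]
    exact ((contDiffOn_endCoord hJ.contMDiff p).contDiffAt
      ((extChartAt_target_isOpen p).mem_nhds hz)).differentiableAt (by simp)
  · intro w hw v
    obtain ⟨r, hr, hr', rfl⟩ := exists_of_mem_coordDomain hw
    rw [← toCoord_ofCoord hr v, hder r hr hr', endCoord_apply J hr, ofCoord_toCoord hr,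
      hder r hr hr', coordMap_extChartAt id hr]
    rw [id, endCoord_apply J (q := r) hr', ofCoord_toCoord (q := r) hr']
  · intro u v
    have h := hJ.parallel q u v
    simp only [christoffel_eq] at h
    rw [← sub_eq_zero, ← h]
    abel

end Immersions

/-! ### Curvature of complex space forms. -/

section Kahler

variable {E : Type*} [NormedAddCommGroup E] [NormedSpace ℝ E] [FiniteDimensional ℝ E]
  {M : Type*} [TopologicalSpace M] [ChartedSpace E M] [IsManifold 𝓘(ℝ, E) ∞ M]
  [RiemannianBundle (fun x : M ↦ TangentSpace 𝓘(ℝ, E) x)]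
  [IsContMDiffRiemannianBundle 𝓘(ℝ, E) ∞ E (fun x : M ↦ TangentSpace 𝓘(ℝ, E) x)]

theorem IsKahler.inner_J_self {J : ∀ p : M, TangentSpace 𝓘(ℝ, E) p →L[ℝ] TangentSpace 𝓘(ℝ, E) p}
    (hJ : IsKahler J) (p : M) (u : TangentSpace 𝓘(ℝ, E) p) : ⟪u, J p u⟫_ℝ = 0 := by
  have h := hJ.inner_apply p u (J p u)
  rw [hJ.apply_apply, inner_neg_right, real_inner_comm] at h
  linarith

/-- The sectional curvature of totally real planes in a complex space form is `c / 4`. -/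
theorem IsComplexSpaceForm.inner_curvature_totallyReal
    {J : ∀ p : M, TangentSpace 𝓘(ℝ, E) p →L[ℝ] TangentSpace 𝓘(ℝ, E) p} {c : ℝ}
    (h : IsComplexSpaceForm J c) (p : M) {u v : TangentSpace 𝓘(ℝ, E) p} (hu : ‖u‖ = 1)
    (hv : ‖v‖ = 1) (huv : ⟪u, v⟫_ℝ = 0) (hJuv : ⟪J p u, v⟫_ℝ = 0) :
    ⟪curvature p u v v, u⟫_ℝ = c / 4 := by
  have hK := h.isKahler
  have hp := mem_chart_source E p
  have hy := extChartAt_mem_target hp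
  have hG := isMetricOn_metricCoord (E := E) p
  have hnorm : ∀ a, ‖J p a‖ = ‖a‖ := fun a ↦ by
    have := hK.inner_apply p a a
    rw [real_inner_self_eq_norm_sq, real_inner_self_eq_norm_sq] at this
    exact (sq_eq_sq₀ (norm_nonneg _) (norm_nonneg _)).1 this
  have hadd₃ : ∀ a b d d' e : TangentSpace 𝓘(ℝ, E) p, ⟪curvature p a b (d + d'), e⟫_ℝ
      = ⟪curvature p a b d, e⟫_ℝ + ⟪curvature p a b d', e⟫_ℝ := by
    intro a b d d' e
    simp only [inner_curvature, ← add_apply, ← map_add]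
    congr 2
    simp only [curvatureMap, map_add]
    abel
  refine totallyReal_curvature (fun a b d e ↦ ⟪curvature p a b d, e⟫_ℝ) (J p) c ?_ hadd₃ ?_ ?_ ?_
    ?_ (fun a b ↦ map_add _ a b) (fun a ↦ map_neg _ a) (hK.apply_apply p) (hK.inner_apply p) ?_
    hu hv huv hJuv
  · intro a a' b d e
    simp only [inner_curvature, ← add_apply, ← map_add]
    congr 2
    simp only [curvatureMap, map_add, add_apply]
    abel
  · intro a b d e
    simp only [inner_curvature]
    rw [IsMetricOn.curvatureMap_antisymm, map_neg, neg_apply]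
  · intro a b d e
    -- Skew-symmetry in the last two arguments, by polarization at `d + e`.
    have hself : ∀ w : TangentSpace 𝓘(ℝ, E) p, ⟪curvature p a b w, w⟫_ℝ = 0 := fun w ↦ by
      rw [inner_curvature]
      exact hG.apply_curvatureMap_self hy _ _ _
    have h1 := hself (d + e)
    rw [hadd₃, inner_add_right, inner_add_right, hself, hself] at h1
    linarith
  · intro a b d e
    simp only [inner_curvature, ← add_apply, ← map_add]
    rw [hG.curvatureMap_bianchi hy, map_zero, zero_apply]
  · intro a b d e
    have hJ : ∀ d, toCoord p p (J p d)
        = endCoord J p (extChartAt 𝓘(ℝ, E) p p) (toCoord p p d) := fun d ↦ by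
      rw [endCoord_apply J hp, ofCoord_toCoord hp]
    have h1 : curvature p a b (J p d) = J p (curvature p a b d) := by
      rw [curvature, curvature, curvatureCoord_eq p hy, curvatureCoord_eq p hy, hJ,
        hG.curvatureMap_parallel (contDiffOn_endCoord hK.contMDiff p)
          (fun z hz ↦ hK.isParallelAt p hz) hy, endCoord_apply J hp, ofCoord_toCoord hp]
    change ⟪curvature p a b (J p d), J p e⟫_ℝ = ⟪curvature p a b d, e⟫_ℝ
    rw [h1, hK.inner_apply]
  · intro a
    by_cases ha : a = 0
    · subst ha
      simp
    · have h1 := h.sectionalCurvature_eq p a ha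
      have h2 := hadd₃ a (J p a) (J p a) 0 a
      have h3 : ‖a‖ ^ 2 * ‖a‖ ^ 2 ≠ 0 := by
        have := norm_ne_zero_iff.2 ha
        positivity
      rw [sectionalCurvature, hnorm, hK.inner_J_self] at h1
      rw [div_eq_iff (by simpa using h3)] at h1
      change ⟪curvature p a (J p a) (J p a), a⟫_ℝ = _
      rw [h1]
      ring

end Kahler

/-! ### Orthonormal frames and invariance of traces. -/

section Frames

theorem sum_sum_Ioi_eq {ι : Type*} [Fintype ι] [LinearOrder ι] [LocallyFiniteOrderTop ι]
    [LocallyFiniteOrderBot ι] (f : ι → ι → ℝ) (hf : ∀ i j, f i j = f j i) :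
    ∑ i, ∑ j ∈ Finset.Ioi i, f i j = 1 / 2 * (∑ i, ∑ j, f i j - ∑ i, f i i) := by
  have h := Finset.sum_sum_Ioi_add_eq_sum_sum_off_diag f
  simp_rw [Finset.compl_eq_univ_sdiff, Finset.sdiff_singleton_eq_erase,
    Finset.sum_erase_eq_sub (Finset.mem_univ _), Finset.sum_add_distrib,
    Finset.sum_sub_distrib] at h
  have h1 : ∑ i, ∑ j ∈ Finset.Ioi i, f j i = ∑ i, ∑ j ∈ Finset.Ioi i, f i j :=
    Finset.sum_congr rfl fun i _ ↦ Finset.sum_congr rfl fun j _ ↦ hf j i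
  have h2 : ∑ i, ∑ j, f j i = ∑ i, ∑ j, f i j :=
    Finset.sum_congr rfl fun i _ ↦ Finset.sum_congr rfl fun j _ ↦ hf j i
  rw [h1, h2] at h
  linarith

variable {V W ι κ : Type*} [NormedAddCommGroup V] [InnerProductSpace ℝ V]
  [NormedAddCommGroup W] [InnerProductSpace ℝ W] [Fintype ι] [Fintype κ]

theorem sum_norm_sq_orthonormalBasis_eq (e : OrthonormalBasis ι ℝ V) (f : OrthonormalBasis κ ℝ V)
    (L : V →ₗ[ℝ] W) : ∑ i, ‖L (e i)‖ ^ 2 = ∑ k, ‖L (f k)‖ ^ 2 := by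
  simpa using sum_orthonormalBasis_eq e f ((innerₗ W).compl₁₂ L L)

theorem sum_sum_norm_sq_orthonormalBasis_eq (e : OrthonormalBasis ι ℝ V)
    (f : OrthonormalBasis κ ℝ V) (B : V →ₗ[ℝ] V →ₗ[ℝ] W) :
    ∑ i, ∑ j, ‖B (e i) (e j)‖ ^ 2 = ∑ k, ∑ l, ‖B (f k) (f l)‖ ^ 2 := by
  have h1 : ∀ i, ∑ j, ‖B (e i) (e j)‖ ^ 2 = ∑ l, ‖B (e i) (f l)‖ ^ 2 := fun i ↦
    sum_norm_sq_orthonormalBasis_eq e f (B (e i))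
  simp_rw [h1]
  rw [Finset.sum_comm]
  conv_rhs => rw [Finset.sum_comm]
  exact Finset.sum_congr rfl fun l _ ↦ sum_norm_sq_orthonormalBasis_eq e f (B.flip (f l))

/-- The sum is the squared norm of the trace of `B` minus its squared Hilbert-Schmidt norm. It
allows `τ`, defined with one fixed frame, to be computed in a frame adapted to the Ricci direction.
-/
theorem sum_gauss_orthonormalBasis_eq (e : OrthonormalBasis ι ℝ V) (f : OrthonormalBasis κ ℝ V)
    (B : V →ₗ[ℝ] V →ₗ[ℝ] W) :
    ∑ i, ∑ j, (⟪B (e i) (e i), B (e j) (e j)⟫_ℝ - ‖B (e i) (e j)‖ ^ 2)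
      = ∑ k, ∑ l, (⟪B (f k) (f k), B (f l) (f l)⟫_ℝ - ‖B (f k) (f l)‖ ^ 2) := by
  simp_rw [Finset.sum_sub_distrib, ← inner_sum, ← sum_inner]
  rw [sum_orthonormalBasis_eq e f, sum_sum_norm_sq_orthonormalBasis_eq e f]

/-- An orthonormal family of maximal size is an orthonormal basis. -/
def orthonormalBasisOfCard [FiniteDimensional ℝ V] {v : ι → V} (hv : Orthonormal ℝ v)
    (hc : Fintype.card ι = Module.finrank ℝ V) : OrthonormalBasis ι ℝ V :=
  OrthonormalBasis.mk hv (hv.linearIndependent.span_eq_top_of_card_eq_finrank' hc).ge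

theorem orthonormalBasisOfCard_apply [FiniteDimensional ℝ V] {v : ι → V} (hv : Orthonormal ℝ v)
    (hc : Fintype.card ι = Module.finrank ℝ V) (i : ι) : orthonormalBasisOfCard hv hc i = v i := by
  simp [orthonormalBasisOfCard]

end Frames

/-! ### The second fundamental form of a Lagrangian submanifold and the pointwise inequality. -/

section SecondFundamentalForm

variable {E : Type*} [NormedAddCommGroup E] [NormedSpace ℝ E] [FiniteDimensional ℝ E]
  {M : Type*} [TopologicalSpace M] [ChartedSpace E M] [IsManifold 𝓘(ℝ, E) ∞ M]
  [RiemannianBundle (fun x : M ↦ TangentSpace 𝓘(ℝ, E) x)]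
  {E' : Type*} [NormedAddCommGroup E'] [NormedSpace ℝ E'] [FiniteDimensional ℝ E']
  {M' : Type*} [TopologicalSpace M'] [ChartedSpace E' M'] [IsManifold 𝓘(ℝ, E') ∞ M']
  [RiemannianBundle (fun x : M' ↦ TangentSpace 𝓘(ℝ, E') x)]

theorem secondFundamentalForm_eq (f : M → M') (x : M) (u v : TangentSpace 𝓘(ℝ, E) x) :
    secondFundamentalForm (E' := E') f x u v = ofCoord (f x) (f x)
      (acceleration (metricCoord (f x)) (coordMap E E' f x (f x)) (extChartAt 𝓘(ℝ, E) x x)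
          (toCoord x x u) (toCoord x x v)
        - fderiv ℝ (coordMap E E' f x (f x)) (extChartAt 𝓘(ℝ, E) x x)
          (christoffelMap (metricCoord x) (extChartAt 𝓘(ℝ, E) x x) (toCoord x x u)
            (toCoord x x v))) :=
  rfl

variable (E E') in
/-- The second fundamental form as a bilinear map. -/
def secondFundamentalFormₗ (f : M → M') (x : M) :
    TangentSpace 𝓘(ℝ, E) x →ₗ[ℝ] TangentSpace 𝓘(ℝ, E) x →ₗ[ℝ] TangentSpace 𝓘(ℝ, E') (f x) :=
  LinearMap.mk₂ ℝ (secondFundamentalForm (E' := E') f x)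
    (fun u u' v ↦ by
      simp only [secondFundamentalForm_eq, acceleration, ← map_add]
      congr 1
      simp only [map_add, add_apply]
      abel)
    (fun a u v ↦ by
      simp only [secondFundamentalForm_eq, acceleration, ← map_smul]
      congr 1
      simp only [smul_sub, smul_add, map_smul, smul_apply])
    (fun u v v' ↦ by
      simp only [secondFundamentalForm_eq, acceleration, ← map_add]
      congr 1
      simp only [map_add]
      abel)
    (fun a u v ↦ by
      simp only [secondFundamentalForm_eq, acceleration, ← map_smul]
      congr 1
      simp only [smul_sub, smul_add, map_smul])

theorem secondFundamentalFormₗ_apply (f : M → M') (x : M) (u v : TangentSpace 𝓘(ℝ, E) x) :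
    secondFundamentalFormₗ E E' f x u v = secondFundamentalForm f x u v := rfl

variable
  [IsContMDiffRiemannianBundle 𝓘(ℝ, E) ∞ E (fun x : M ↦ TangentSpace 𝓘(ℝ, E) x)]
  [IsContMDiffRiemannianBundle 𝓘(ℝ, E') ∞ E' (fun x : M' ↦ TangentSpace 𝓘(ℝ, E') x)]

theorem toCoord_secondFundamentalForm (f : M → M') (x : M) (u v : TangentSpace 𝓘(ℝ, E) x) :
    toCoord (f x) (f x) (secondFundamentalForm (E' := E') f x u v)
      = acceleration (metricCoord (f x)) (coordMap E E' f x (f x)) (extChartAt 𝓘(ℝ, E) x x)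
          (toCoord x x u) (toCoord x x v)
        - fderiv ℝ (coordMap E E' f x (f x)) (extChartAt 𝓘(ℝ, E) x x)
          (christoffelMap (metricCoord x) (extChartAt 𝓘(ℝ, E) x x) (toCoord x x u)
            (toCoord x x v)) := by
  rw [secondFundamentalForm_eq, toCoord_ofCoord (mem_chart_source E' (f x))]

namespace IsIsometricImmersion

variable {f : M → M'}

theorem inner_secondFundamentalForm_mfderiv (hf : IsIsometricImmersion E E' f) (x : M)
    (u v w : TangentSpace 𝓘(ℝ, E) x) :
    ⟪secondFundamentalForm f x u v, mfderiv 𝓘(ℝ, E) 𝓘(ℝ, E') f x w⟫_ℝ = 0 := by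
  have hx := mem_chart_source E x
  have hfx := mem_chart_source E' (f x)
  rw [← metricCoord_toCoord hfx, toCoord_secondFundamentalForm,
    ← fderiv_coordMap hf.contMDiff hx hfx, ← coordMap_extChartAt (E := E) f hx]
  exact (isIsometricOn_coordMap hf x (f x)).inner_acceleration_sub
    (extChartAt_mem_coordDomain hx hfx) _ _ _

theorem secondFundamentalForm_symm (hf : IsIsometricImmersion E E' f) (x : M)
    (u v : TangentSpace 𝓘(ℝ, E) x) :
    secondFundamentalForm (E' := E') f x u v = secondFundamentalForm f x v u := by
  have hx := mem_chart_source E x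
  have hy := extChartAt_mem_coordDomain (f := f) hx (mem_chart_source E' (f x))
  have h := isIsometricOn_coordMap hf x (f x)
  rw [secondFundamentalForm_eq, secondFundamentalForm_eq, h.acceleration_symm hy,
    h.source.christoffelMap_symm hy]

/-- The Gauss equation. -/
theorem inner_curvature_eq (hf : IsIsometricImmersion E E' f) (x : M)
    (u v : TangentSpace 𝓘(ℝ, E) x) :
    ⟪curvature x u v v, u⟫_ℝ
      = ⟪curvature (f x) (mfderiv 𝓘(ℝ, E) 𝓘(ℝ, E') f x u) (mfderiv 𝓘(ℝ, E) 𝓘(ℝ, E') f x v)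
          (mfderiv 𝓘(ℝ, E) 𝓘(ℝ, E') f x v), mfderiv 𝓘(ℝ, E) 𝓘(ℝ, E') f x u⟫_ℝ
        + ⟪secondFundamentalForm (E' := E') f x u u, secondFundamentalForm f x v v⟫_ℝ
        - ‖secondFundamentalForm (E' := E') f x u v‖ ^ 2 := by
  have hx := mem_chart_source E x
  have hfx := mem_chart_source E' (f x)
  have hy := extChartAt_mem_coordDomain (f := f) hx hfx
  have h := (isIsometricOn_coordMap hf x (f x)).gauss_sub hy (toCoord x x u) (toCoord x x v)
    (toCoord x x v) (toCoord x x u)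
  simp only [← toCoord_secondFundamentalForm, fderiv_coordMap hf.contMDiff hx hfx,
    coordMap_extChartAt f hx, metricCoord_toCoord hfx] at h
  rw [inner_curvature, inner_curvature, h, hf.secondFundamentalForm_symm x v u,
    real_inner_self_eq_norm_sq, real_inner_comm (secondFundamentalForm f x v v)]

end IsIsometricImmersion

variable {f : M → M'} {J : ∀ p : M', TangentSpace 𝓘(ℝ, E') p →L[ℝ] TangentSpace 𝓘(ℝ, E') p}

/-- The cubic form of a Lagrangian submanifold of a Kähler manifold is symmetric. -/
theorem IsLagrangian.inner_secondFundamentalForm_J (hf : IsLagrangian E f J) (hJ : IsKahler J)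
    (x : M) (u v w : TangentSpace 𝓘(ℝ, E) x) :
    ⟪secondFundamentalForm f x u v, J (f x) (mfderiv 𝓘(ℝ, E) 𝓘(ℝ, E') f x w)⟫_ℝ
      = ⟪secondFundamentalForm f x u w, J (f x) (mfderiv 𝓘(ℝ, E) 𝓘(ℝ, E') f x v)⟫_ℝ := by
  have hi := hf.isIsometricImmersion
  have hx := mem_chart_source E x
  have hfx := mem_chart_source E' (f x)
  have hy := extChartAt_mem_coordDomain (f := f) hx hfx
  have hFy := coordMap_extChartAt (E := E) (E' := E') f (p' := f x) hx
  have h := isIsometricOn_coordMap hi x (f x)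
  have hnormal : ∀ a w : TangentSpace 𝓘(ℝ, E) x,
      ⟪mfderiv 𝓘(ℝ, E) 𝓘(ℝ, E') f x a, J (f x) (mfderiv 𝓘(ℝ, E) 𝓘(ℝ, E') f x w)⟫_ℝ = 0 :=
    fun a w ↦ by rw [real_inner_comm]; exact hf.inner_eq_zero x w a
  have hJtoCoord : ∀ (q : M'), q ∈ (chartAt E' (f x)).source → ∀ a : TangentSpace 𝓘(ℝ, E') q,
      endCoord J (f x) (extChartAt 𝓘(ℝ, E') (f x) q) (toCoord (f x) q a)
        = toCoord (f x) q (J q a) := fun q hq a ↦ by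
    rw [endCoord_apply J hq, ofCoord_toCoord hq]
  have hcubic := h.inner_acceleration_J hy (J' := endCoord J (f x)) ?_ ?_ ?_ ?_
    (toCoord x x u) (toCoord x x v) (toCoord x x w)
  -- The second fundamental form may be replaced by the full acceleration, since their difference is
  -- tangent and hence orthogonal to `J df w`.
  · have key : ∀ v w : TangentSpace 𝓘(ℝ, E) x,
        ⟪secondFundamentalForm f x u v, J (f x) (mfderiv 𝓘(ℝ, E) 𝓘(ℝ, E') f x w)⟫_ℝ
        = metricCoord (f x) (extChartAt 𝓘(ℝ, E') (f x) (f x))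
          (acceleration (metricCoord (f x)) (coordMap E E' f x (f x)) (extChartAt 𝓘(ℝ, E) x x)
            (toCoord x x u) (toCoord x x v))
          (toCoord (f x) (f x) (J (f x) (mfderiv 𝓘(ℝ, E) 𝓘(ℝ, E') f x w))) := by
      intro v w
      rw [← metricCoord_toCoord hfx, toCoord_secondFundamentalForm, map_sub, sub_apply,
        ← toCoord_ofCoord hx (christoffelMap _ _ _ _), fderiv_coordMap hi.contMDiff hx hfx,
        metricCoord_toCoord hfx (mfderiv 𝓘(ℝ, E) 𝓘(ℝ, E') f x _), hnormal, sub_zero]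
    rw [hFy, fderiv_coordMap hi.contMDiff hx hfx, fderiv_coordMap hi.contMDiff hx hfx,
      hJtoCoord _ hfx, hJtoCoord _ hfx] at hcubic
    rw [key, key, hcubic]
  · rw [hFy]
    exact ((contDiffOn_endCoord hJ.contMDiff (f x)).contDiffAt
      ((extChartAt_target_isOpen (f x)).mem_nhds (extChartAt_mem_target hfx))).differentiableAt
      (by simp)
  · rw [hFy]
    exact hJ.isParallelAt (f x) (extChartAt_mem_target hfx)
  · intro a b
    rw [hFy, ← toCoord_ofCoord hfx a, ← toCoord_ofCoord hfx b, hJtoCoord _ hfx, hJtoCoord _ hfx,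
      metricCoord_toCoord hfx, metricCoord_toCoord hfx, ← hJ.inner_apply, hJ.apply_apply,
      inner_neg_left]
  · intro z hz a b
    obtain ⟨q, hq, hfq, rfl⟩ := exists_of_mem_coordDomain hz
    rw [← toCoord_ofCoord hq a, ← toCoord_ofCoord hq b, fderiv_coordMap hi.contMDiff hq hfq,
      fderiv_coordMap hi.contMDiff hq hfq, coordMap_extChartAt f hq, hJtoCoord _ hfq,
      metricCoord_toCoord hfq, real_inner_comm]
    exact hf.inner_eq_zero q _ _

/-- The Gauss equation, where the ambient term is `c / 4` because `df` maps an orthonormal pair to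
one spanning a totally real plane. -/
theorem IsLagrangian.sectionalCurvature_eq (hf : IsLagrangian E f J) {c : ℝ}
    (hM' : IsComplexSpaceForm J c) (x : M) {u v : TangentSpace 𝓘(ℝ, E) x} (hu : ‖u‖ = 1)
    (hv : ‖v‖ = 1) (huv : ⟪u, v⟫_ℝ = 0) :
    sectionalCurvature x u v = c / 4
      + (⟪secondFundamentalForm (E' := E') f x u u, secondFundamentalForm f x v v⟫_ℝ
        - ‖secondFundamentalForm (E' := E') f x u v‖ ^ 2) := by
  have hi := hf.isIsometricImmersion
  have hnorm : ∀ u : TangentSpace 𝓘(ℝ, E) x, ‖mfderiv 𝓘(ℝ, E) 𝓘(ℝ, E') f x u‖ = ‖u‖ := fun u ↦ by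
    have := hi.inner_mfderiv x u u
    rw [real_inner_self_eq_norm_sq, real_inner_self_eq_norm_sq] at this
    exact (sq_eq_sq₀ (norm_nonneg _) (norm_nonneg _)).1 this
  have h := hM'.inner_curvature_totallyReal (f x) ((hnorm u).trans hu) ((hnorm v).trans hv)
    ((hi.inner_mfderiv x u v).trans huv) (hf.inner_eq_zero x u v)
  rw [sectionalCurvature, hi.inner_curvature_eq, h, hu, hv, huv]
  norm_num
  ring

/-- The inner product of normal vectors in terms of the normal frame `J e_k`. -/
theorem IsLagrangian.inner_normal_eq (hf : IsLagrangian E f J) (hJ : IsKahler J) (x : M)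
    {ι : Type*} [Fintype ι] (b : OrthonormalBasis ι ℝ (TangentSpace 𝓘(ℝ, E) x))
    {X Y : TangentSpace 𝓘(ℝ, E') (f x)}
    (hX : ∀ w, ⟪X, mfderiv 𝓘(ℝ, E) 𝓘(ℝ, E') f x w⟫_ℝ = 0) :
    ⟪X, Y⟫_ℝ = ∑ k, ⟪X, J (f x) (mfderiv 𝓘(ℝ, E) 𝓘(ℝ, E') f x (b k))⟫_ℝ
      * ⟪Y, J (f x) (mfderiv 𝓘(ℝ, E) 𝓘(ℝ, E') f x (b k))⟫_ℝ := by
  classical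
  have hi := hf.isIsometricImmersion
  have hb := orthonormal_iff_ite.1 b.orthonormal
  let e : ι ⊕ ι → TangentSpace 𝓘(ℝ, E') (f x) :=
    Sum.elim (fun k ↦ mfderiv 𝓘(ℝ, E) 𝓘(ℝ, E') f x (b k))
      (fun k ↦ J (f x) (mfderiv 𝓘(ℝ, E) 𝓘(ℝ, E') f x (b k)))
  have he : Orthonormal ℝ e := by
    rw [orthonormal_iff_ite]
    rintro (i | i) (j | j)
    · simp only [e, Sum.elim_inl, hi.inner_mfderiv, hb, Sum.inl.injEq]
    · simp only [e, Sum.elim_inl, Sum.elim_inr, reduceCtorEq, if_false]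
      rw [real_inner_comm]
      exact hf.inner_eq_zero x _ _
    · simp only [e, Sum.elim_inl, Sum.elim_inr, reduceCtorEq, if_false]
      exact hf.inner_eq_zero x _ _
    · simp only [e, Sum.elim_inr, hJ.inner_apply, hi.inner_mfderiv, hb, Sum.inr.injEq]
  have hcard : Fintype.card ι = Module.finrank ℝ E :=
    (Module.finrank_eq_card_basis b.toBasis).symm
  -- The half-dimensionality of `M` makes `df e_k`, `J df e_k` a full basis. In Parseval's identity
  -- the tangential products vanish as soon as `X` is normal.
  have hc : Fintype.card (ι ⊕ ι) = Module.finrank ℝ (TangentSpace 𝓘(ℝ, E') (f x)) := by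
    rw [Fintype.card_sum, hcard, ← two_mul]
    exact hf.finrank_eq.symm
  rw [← (orthonormalBasisOfCard he hc).sum_inner_mul_inner X Y, Fintype.sum_sum_type]
  simp only [orthonormalBasisOfCard_apply, e, Sum.elim_inl, Sum.elim_inr, hX, zero_mul,
    Finset.sum_const_zero, zero_add]
  exact Finset.sum_congr rfl fun k _ ↦ by
    rw [real_inner_comm Y]

variable {ι : Type*} [Fintype ι] [DecidableEq ι]

/-- The scalar curvature of a Lagrangian submanifold of a complex space form. -/
theorem IsLagrangian.scalarCurvature_eq (hf : IsLagrangian E f J) {c : ℝ}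
    (hM' : IsComplexSpaceForm J c) (x : M)
    (b : OrthonormalBasis ι ℝ (TangentSpace 𝓘(ℝ, E) x)) :
    scalarCurvature E x = (Fintype.card ι : ℝ) * ((Fintype.card ι : ℝ) - 1) / 8 * c
      + 1 / 2 * ∑ i, ∑ j,
        (⟪secondFundamentalForm (E' := E') f x (b i) (b i), secondFundamentalForm f x (b j) (b j)⟫_ℝ
          - ‖secondFundamentalForm (E' := E') f x (b i) (b j)‖ ^ 2) := by
  have hi := hf.isIsometricImmersion
  set e := frame E x
  have h1 : scalarCurvature E x = ∑ i, ∑ j ∈ Finset.Ioi i, (c / 4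
      + (⟪secondFundamentalForm (E' := E') f x (e i) (e i), secondFundamentalForm f x (e j) (e j)⟫_ℝ
        - ‖secondFundamentalForm (E' := E') f x (e i) (e j)‖ ^ 2)) := by
    refine Finset.sum_congr rfl fun i _ ↦ Finset.sum_congr rfl fun j hj ↦ ?_
    exact hf.sectionalCurvature_eq hM' x (e.orthonormal.1 i) (e.orthonormal.1 j)
      (e.orthonormal.2 (Finset.mem_Ioi.1 hj).ne)
  have hcard : Fintype.card ι = Module.finrank ℝ (TangentSpace 𝓘(ℝ, E) x) :=
    (Module.finrank_eq_card_basis b.toBasis).symm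
  have hsum := sum_gauss_orthonormalBasis_eq e b (secondFundamentalFormₗ E E' f x)
  simp only [secondFundamentalFormₗ_apply] at hsum
  -- The Gauss expression extends to `i = j` with value `c / 4`, its second-fundamental-form part
  -- being zero there; removing the diagonal leaves `n * (n - 1)` copies of `c / 4`, halved.
  rw [h1, sum_sum_Ioi_eq]
  · simp only [Finset.sum_add_distrib, hsum, real_inner_self_eq_norm_sq,
      sub_self, add_zero, Finset.sum_const, Finset.card_univ, Fintype.card_fin, ← hcard,
      nsmul_eq_mul]
    ring
  · intro i j
    rw [hi.secondFundamentalForm_symm x (e j) (e i), real_inner_comm]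

/-- The inequality at a point for a given orthonormal frame. -/
theorem IsLagrangian.scalarCurvature_sub_le (hf : IsLagrangian E f J) {c : ℝ}
    (hM' : IsComplexSpaceForm J c) (x : M) (hn : 3 ≤ Fintype.card ι)
    (b : OrthonormalBasis ι ℝ (TangentSpace 𝓘(ℝ, E) x)) (o : ι) {n : ℝ}
    (hcard : (Fintype.card ι : ℝ) = n) :
    scalarCurvature E x
        - 1 / (n - 1) * ∑ j ∈ Finset.univ.erase o, sectionalCurvature x (b o) (b j)
      ≤ (n + 1) * (n - 2) / 8 * c
        + (3 * n - 1) * (n - 2) * n ^ 2 / (2 * (3 * n + 5) * (n - 1))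
          * ‖meanCurvature E E' f x‖ ^ 2 := by
  have hi := hf.isIsometricImmersion
  have hJ := hM'.isKahler
  let σ : ι → ι → ι → ℝ := fun i j k ↦
    ⟪secondFundamentalForm f x (b i) (b j), J (f x) (mfderiv 𝓘(ℝ, E) 𝓘(ℝ, E') f x (b k))⟫_ℝ
  have hσ : ∀ i j k l, ⟪secondFundamentalForm (E' := E') f x (b i) (b j),
      secondFundamentalForm f x (b k) (b l)⟫_ℝ = ∑ r, σ i j r * σ k l r := fun i j k l ↦
    hf.inner_normal_eq hJ x b (hi.inner_secondFundamentalForm_mfderiv x _ _)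
  have hA : ∀ i j, ⟪secondFundamentalForm (E' := E') f x (b i) (b i),
        secondFundamentalForm f x (b j) (b j)⟫_ℝ
      - ‖secondFundamentalForm (E' := E') f x (b i) (b j)‖ ^ 2
      = ∑ r, (σ i i r * σ j j r - σ i j r ^ 2) := by
    intro i j
    rw [← real_inner_self_eq_norm_sq, hσ, hσ, ← Finset.sum_sub_distrib]
    exact Finset.sum_congr rfl fun r _ ↦ by ring
  have hn3 : (3 : ℝ) ≤ n := by rw [← hcard]; exact_mod_cast hn
  have hτ := hf.scalarCurvature_eq hM' x b
  simp only [hA, hcard] at hτ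
  have hRic : ∑ j ∈ Finset.univ.erase o, sectionalCurvature x (b o) (b j)
      = (n - 1) * (c / 4) + ∑ j, ∑ r, (σ o o r * σ j j r - σ o j r ^ 2) := by
    have h1 : ∑ j ∈ Finset.univ.erase o, sectionalCurvature x (b o) (b j)
        = ∑ j ∈ Finset.univ.erase o, (c / 4 + ∑ r, (σ o o r * σ j j r - σ o j r ^ 2)) := by
      refine Finset.sum_congr rfl fun j hj ↦ ?_
      rw [hf.sectionalCurvature_eq hM' x (b.orthonormal.1 o) (b.orthonormal.1 j)
        (b.orthonormal.2 (Finset.ne_of_mem_erase hj).symm), hA]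
    have h2 : ∑ r, (σ o o r * σ o o r - σ o o r ^ 2) = 0 :=
      Finset.sum_eq_zero fun r _ ↦ by ring
    rw [h1, Finset.sum_erase_eq_sub (Finset.mem_univ o), Finset.sum_add_distrib, h2]
    simp only [Finset.sum_const, Finset.card_univ, nsmul_eq_mul, hcard]
    ring
  have hH : n ^ 2 * ‖meanCurvature E E' f x‖ ^ 2 = ∑ r, (∑ i, σ i i r) ^ 2 := by
    have h1 : meanCurvature E E' f x
        = (1 / n) • ∑ i, secondFundamentalForm (E' := E') f x (b i) (b i) := by
      have h2 := sum_orthonormalBasis_eq (frame E x) b (secondFundamentalFormₗ E E' f x)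
      simp only [secondFundamentalFormₗ_apply] at h2
      have h3 : (Module.finrank ℝ E : ℝ) = n := by
        rw [← hcard]
        exact_mod_cast Module.finrank_eq_card_basis b.toBasis
      rw [meanCurvature, h2, h3]
    have h4 : n ≠ 0 := by linarith
    rw [h1, norm_smul, mul_pow, ← real_inner_self_eq_norm_sq (∑ i, _), sum_inner]
    simp only [inner_sum, hσ]
    rw [← mul_assoc, Real.norm_eq_abs, sq_abs]
    have h5 : n ^ 2 * (1 / n) ^ 2 = 1 := by field_simp
    rw [h5, one_mul]
    simp_rw [sq, Finset.sum_mul_sum]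
    conv_rhs => rw [Finset.sum_comm]
    exact Finset.sum_congr rfl fun i _ ↦ Finset.sum_comm
  have hbound := symmetric_cubic_bound hn o σ
    (fun i j k ↦ by simp only [σ]; rw [hi.secondFundamentalForm_symm])
    (fun i j k ↦ hf.inner_secondFundamentalForm_J hJ x (b i) (b j) (b k))
    (m := n - 1) (by rw [hcard])
  rw [← hH] at hbound
  rw [hτ, hRic]
  -- The coefficient of `c` becomes `n * (n - 1) / 8 - 1 / 4 = (n + 1) * (n - 2) / 8`.
  have e1 : 1 / (n - 1) * ((n - 1) * (c / 4)) = c / 4 := by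
    have : n - 1 ≠ 0 := by linarith
    field_simp
  have e2 : (3 * (n - 1) + 2) * (n - 1 - 1) / (2 * (3 * (n - 1) + 8) * (n - 1))
      * (n ^ 2 * ‖meanCurvature E E' f x‖ ^ 2)
      = (3 * n - 1) * (n - 2) * n ^ 2 / (2 * (3 * n + 5) * (n - 1))
        * ‖meanCurvature E E' f x‖ ^ 2 := by
    rw [show 3 * (n - 1) + 2 = 3 * n - 1 by ring, show 3 * (n - 1) + 8 = 3 * n + 5 by ring,
      show n - 1 - 1 = n - 2 by ring]
    ring
  rw [e2] at hbound
  rw [mul_add, e1]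
  linarith

end SecondFundamentalForm

/-- A lower bound of a set of reals passes to `sInf` only when the set is nonempty, as `sInf ∅ = 0`.
-/
theorem kRicciValues_nonempty {n : ℕ} (hn : 3 ≤ n)
    {E : Type*} [NormedAddCommGroup E] [NormedSpace ℝ E] [FiniteDimensional ℝ E]
    (hE : Module.finrank ℝ E = n)
    {M : Type*} [TopologicalSpace M] [ChartedSpace E M] [IsManifold 𝓘(ℝ, E) ∞ M]
    [RiemannianBundle (fun x : M ↦ TangentSpace 𝓘(ℝ, E) x)] (x : M) :
    (kRicciValues E n x).Nonempty := by
  have hV : Module.finrank ℝ (TangentSpace 𝓘(ℝ, E) x) = n := hE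
  let b := (stdOrthonormalBasis ℝ (TangentSpace 𝓘(ℝ, E) x)).reindex (finCongr hV)
  have hn0 : 0 < n := by omega
  exact ⟨_, ⊤, by rw [finrank_top]; exact hV, b ⟨0, hn0⟩, Submodule.mem_top, b.orthonormal.1 _, b,
    ⟨0, hn0⟩, b.orthonormal, fun _ ↦ Submodule.mem_top, rfl, rfl⟩

end RiemannianGeometry

end

theorem theorem4p2 {n : ℕ} (hn : 3 ≤ n)
    {E : Type*} [NormedAddCommGroup E] [NormedSpace ℝ E] [FiniteDimensional ℝ E]
    (hE : Module.finrank ℝ E = n)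
    {M : Type*} [TopologicalSpace M] [ChartedSpace E M] [IsManifold 𝓘(ℝ, E) ∞ M]
    [RiemannianBundle (fun x : M ↦ TangentSpace 𝓘(ℝ, E) x)]
    [IsContMDiffRiemannianBundle 𝓘(ℝ, E) ∞ E (fun x : M ↦ TangentSpace 𝓘(ℝ, E) x)]
    {E' : Type*} [NormedAddCommGroup E'] [NormedSpace ℝ E'] [FiniteDimensional ℝ E']
    (hE' : Module.finrank ℝ E' = 2 * n)
    {M' : Type*} [TopologicalSpace M'] [ChartedSpace E' M'] [IsManifold 𝓘(ℝ, E') ∞ M']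
    [RiemannianBundle (fun x : M' ↦ TangentSpace 𝓘(ℝ, E') x)]
    [IsContMDiffRiemannianBundle 𝓘(ℝ, E') ∞ E' (fun x : M' ↦ TangentSpace 𝓘(ℝ, E') x)]
    (J : ∀ p : M', TangentSpace 𝓘(ℝ, E') p →L[ℝ] TangentSpace 𝓘(ℝ, E') p) (c : ℝ)
    (hM' : RiemannianGeometry.IsComplexSpaceForm J c)
    (f : M → M') (hf : RiemannianGeometry.IsLagrangian E f J) (x : M) :
    RiemannianGeometry.delta E n x ≤
      ((n : ℝ) + 1) * ((n : ℝ) - 2) / 8 * c +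
        (3 * (n : ℝ) - 1) * ((n : ℝ) - 2) * (n : ℝ) ^ 2 /
          (2 * (3 * (n : ℝ) + 5) * ((n : ℝ) - 1)) *
          ‖RiemannianGeometry.meanCurvature E E' f x‖ ^ 2 := by
  set B := ((n : ℝ) + 1) * ((n : ℝ) - 2) / 8 * c +
        (3 * (n : ℝ) - 1) * ((n : ℝ) - 2) * (n : ℝ) ^ 2 /
          (2 * (3 * (n : ℝ) + 5) * ((n : ℝ) - 1)) *
          ‖RiemannianGeometry.meanCurvature E E' f x‖ ^ 2 with hB
  have hn1 : (0 : ℝ) < (n : ℝ) - 1 := by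
    have : (3 : ℝ) ≤ n := by exact_mod_cast hn
    linarith
  have hinf : ((n : ℝ) - 1) * (RiemannianGeometry.scalarCurvature E x - B)
      ≤ sInf (RiemannianGeometry.kRicciValues E n x) := by
    refine le_csInf (RiemannianGeometry.kRicciValues_nonempty hn hE x) ?_
    -- For `k = n` the subspace plays no role: the `n` orthonormal vectors `e` already form a basis
    -- of the tangent space, with `X = e i` as distinguished vector.
    rintro r ⟨L, -, X, -, -, e, i, he, -, rfl, rfl⟩
    have hV : Module.finrank ℝ (TangentSpace 𝓘(ℝ, E) x) = n := hE
    let b := RiemannianGeometry.orthonormalBasisOfCard he (by rw [Fintype.card_fin, hV])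
    have hb : ∀ j, b j = e j := RiemannianGeometry.orthonormalBasisOfCard_apply he _
    have h := hf.scalarCurvature_sub_le hM' x (by rwa [Fintype.card_fin]) b i (n := n)
      (by rw [Fintype.card_fin])
    simp only [hb] at h
    rw [← hB, one_div_mul_eq_div, sub_le_comm, le_div_iff₀ hn1] at h
    linarith
  rw [RiemannianGeometry.delta, RiemannianGeometry.theta, one_div_mul_eq_div, sub_le_comm,
    le_div_iff₀ hn1]
  linarith
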